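/- Let $k$ be a perfect field of characteristic $\neq 2$, let $q$ be a regular quadratic form over $k$ in $n\ge 2$ variables, and let $Q\subseteq\mathbb{P}^{n-1}_k$ be the (smooth) projective quadric $q=0$. Let $\mathrm{GW}(F)$ denote the Grothendieck–Witt ring of regular quadratic forms over a field $F$ of characteristic $\ne 2$. For every closed point $x\in Q$ choose a nonzero $k$-linear functional $s_x\colon k(x)\to k$ on the residue field, and let $(s_x)_*\colon \mathrm{GW}(k(x))\to\mathrm{GW}(k)$ be the Scharlau transfer, i.e. the additive homomorphism sending a form $\psi$ on a $k(x)$-vector space $V$ to the form $v\mapsto s_x(\psi(v))$ on the $k$-vector space $V$. Let $$\mathrm{GI}^{\mathrm{tr}}_Q=\sum_{x} (s_x)_*\big(\mathrm{GW}(k(x))\big)\subseteq \mathrm{GW}(k)$$ be the transfer ideal of $Q$, where the sum is over all closed points $x$ of $Q$. Let $D(q)\subseteq k^\times$ be the set of nonzero values of $q$, and let $[D(q)^2]$ be the subgroup of $k^\times$ generated by the products $ab$ with $a,b\in D(q)$. For $\phi\in\mathrm{GW}(k)$ of (virtual) dimension $m$ let $\delta_\pm(\phi)=(-1)^{m(m-1)/2}\det\phi\in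 k^\times/(k^\times)^2$ be its signed discriminant. Then: 1. for every $\phi\in \mathrm{GI}^{\mathrm{tr}}_Q$, the signed discriminant $\delta_\pm(\phi)$ lies in the image of $[D(q)^2]$ in $k^\times/(k^\times)^2$; 2. for all $a,b\in k^\times$, the class of the form $\langle a,b\rangle=ax^2+by^2$ lies in $\mathrm{GI}^{\mathrm{tr}}_Q$ if and only if $-ab\in[D(q)^2]$. -/

import Mathlib

open scoped TensorProduct

universe u

namespace GWTransfer

noncomputable section

/-! ### Regular quadratic spaces and the Grothendieck-Witt ring -/

/-- A finite dimensional vector space over `F` with a regular (nondegenerate) quadratic form. -/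
structure QuadSpace (F : Type u) [Field F] : Type (u + 1) where
  carrier : Type u
  [addCommGroup : AddCommGroup carrier]
  [module : Module F carrier]
  [finite : FiniteDimensional F carrier]
  form : QuadraticForm F carrier
  regular : form.Nondegenerate

attribute [instance] QuadSpace.addCommGroup QuadSpace.module QuadSpace.finite

/-- Two quadratic spaces are identified when they are isometric. -/
instance QuadSpace.setoid (F : Type u) [Field F] : Setoid (QuadSpace F) where
  r S T := S.form.Equivalent T.form
  iseqv := ⟨fun S => .refl S.form, fun h => h.symm, fun h h' => h.trans h'⟩

/-- Isometry classes of regular quadratic spaces over `F`. -/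
def IsoClass (F : Type u) [Field F] : Type (u + 1) := Quotient (QuadSpace.setoid F)

section Regularity

variable {F : Type u} [Field F] [Invertible (2 : F)]

theorem nondegenerate_iff {V : Type*} [AddCommGroup V] [Module F V] (Q : QuadraticForm F V) :
    Q.Nondegenerate ↔ ∀ x, (∀ y, QuadraticMap.associated Q x y = 0) → x = 0 := by
  rw [QuadraticMap.nondegenerate_iff_radical_eq_bot, QuadraticMap.radical_eq_ker_associated,
    LinearMap.ker_eq_bot']
  simp [LinearMap.ext_iff]

theorem nondegenerate_prod {V W : Type*} [AddCommGroup V] [Module F V] [AddCommGroup W]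
    [Module F W] {Q : QuadraticForm F V} {Q' : QuadraticForm F W}
    (h : Q.Nondegenerate) (h' : Q'.Nondegenerate) :
    (QuadraticMap.prod Q Q').Nondegenerate := by
  rw [nondegenerate_iff] at *
  rintro ⟨x, x'⟩ hx
  have h1 := h x fun y => by simpa using hx (y, 0)
  have h2 := h' x' fun y => by simpa using hx (0, y)
  simp [h1, h2]

/-- Regularity of a tensor product; the left form may live over an extension `E` of `F`. -/
theorem nondegenerate_tmul {E : Type*} [Field E] [Algebra F E] [Invertible (2 : E)]
    {V W : Type*} [AddCommGroup V] [Module F V] [Module E V] [IsScalarTower F E V]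
    [AddCommGroup W] [Module F W] [FiniteDimensional F W]
    {Q : QuadraticForm E V} {Q' : QuadraticForm F W}
    (h : Q.Nondegenerate) (h' : Q'.Nondegenerate) :
    (QuadraticForm.tmul Q Q').Nondegenerate := by
  rw [nondegenerate_iff] at *
  obtain ⟨b, hb⟩ := LinearMap.BilinForm.exists_orthogonal_basis
    (B := QuadraticMap.associated Q') ⟨QuadraticMap.associated_isSymm F Q'⟩
  have hbo : ∀ i j, i ≠ j → QuadraticMap.associated Q' (b i) (b j) = 0 := fun i j hij => hb hij
  have hb0 : ∀ j, QuadraticMap.associated Q' (b j) (b j) ≠ 0 := by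
    intro j hj
    refine b.ne_zero j (h' _ fun y => ?_)
    have : QuadraticMap.associated Q' (b j) = 0 := by
      refine b.ext fun i => ?_
      by_cases hij : j = i
      · subst hij; simpa using hj
      · simpa using hbo _ _ hij
    simp [this]
  have key : ∀ x : V ⊗[F] W, ∃ v : Fin (Module.finrank F W) → V, x = ∑ i, v i ⊗ₜ b i := by
    intro x
    induction x with
    | zero => exact ⟨0, by simp⟩
    | tmul a w =>
      refine ⟨fun i => b.repr w i • a, ?_⟩
      conv_lhs => rw [← b.sum_repr w]
      rw [TensorProduct.tmul_sum]
      simp [TensorProduct.smul_tmul]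
    | add x y hx hy =>
      obtain ⟨v, rfl⟩ := hx
      obtain ⟨w, rfl⟩ := hy
      exact ⟨v + w, by simp [TensorProduct.add_tmul, Finset.sum_add_distrib]⟩
  intro x hx
  obtain ⟨v, rfl⟩ := key x
  refine Finset.sum_eq_zero fun j _ => ?_
  have : v j = 0 := by
    refine h _ fun y => ?_
    have h1 := hx (y ⊗ₜ b j)
    rw [QuadraticForm.associated_tmul, map_sum, LinearMap.sum_apply,
      Finset.sum_eq_single j] at h1
    · rw [LinearMap.BilinForm.tensorDistrib_tmul] at h1
      simpa [hb0 j] using h1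
    · intro i _ hij
      rw [LinearMap.BilinForm.tensorDistrib_tmul, hbo i j hij, zero_smul]
    · simp
  rw [this, TensorProduct.zero_tmul]

theorem nondegenerate_sq : (QuadraticMap.sq : QuadraticForm F F).Nondegenerate := by
  rw [nondegenerate_iff]
  intro x hx
  simpa using hx 1

theorem nondegenerate_zero {V : Type*} [AddCommGroup V] [Module F V] [Subsingleton V] :
    (0 : QuadraticForm F V).Nondegenerate := by
  rw [nondegenerate_iff]
  intro x _
  exact Subsingleton.elim _ _

end Regularity

namespace QuadSpace

variable {F : Type u} [Field F] [Invertible (2 : F)]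

/-- The zero space. -/
def zero (F : Type u) [Field F] [Invertible (2 : F)] : QuadSpace F where
  carrier := PUnit
  form := 0
  regular := nondegenerate_zero

/-- The form `⟨1⟩`. -/
def one (F : Type u) [Field F] [Invertible (2 : F)] : QuadSpace F where
  carrier := F
  form := QuadraticMap.sq
  regular := nondegenerate_sq

/-- Orthogonal sum. -/
def add (S T : QuadSpace F) : QuadSpace F where
  carrier := S.carrier × T.carrier
  form := QuadraticMap.prod S.form T.form
  regular := nondegenerate_prod S.regular T.regular

/-- Tensor product. -/
def mul (S T : QuadSpace F) : QuadSpace F where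
  carrier := S.carrier ⊗[F] T.carrier
  form := QuadraticForm.tmul S.form T.form
  regular := nondegenerate_tmul S.regular T.regular

end QuadSpace

section Isometries

variable {F : Type u} [Field F]
variable {V₁ V₂ V₃ V₄ : Type*} [AddCommGroup V₁] [Module F V₁] [AddCommGroup V₂] [Module F V₂]
  [AddCommGroup V₃] [Module F V₃] [AddCommGroup V₄] [Module F V₄]

theorem equivalent_tmul [Invertible (2 : F)] {Q₁ : QuadraticForm F V₁} {Q₂ : QuadraticForm F V₂}
    {Q₃ : QuadraticForm F V₃} {Q₄ : QuadraticForm F V₄}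
    (h : Q₁.Equivalent Q₂) (h' : Q₃.Equivalent Q₄) :
    (Q₁.tmul Q₃).Equivalent (Q₂.tmul Q₄) := by
  obtain ⟨e⟩ := h
  obtain ⟨e'⟩ := h'
  exact ⟨{ TensorProduct.congr e.toLinearEquiv e'.toLinearEquiv with
    map_app' := fun m => QuadraticForm.tmul_tensorMap_apply e.toIsometry e'.toIsometry m }⟩

theorem equivalent_prod_assoc (Q₁ : QuadraticForm F V₁) (Q₂ : QuadraticForm F V₂)
    (Q₃ : QuadraticForm F V₃) :
    ((Q₁.prod Q₂).prod Q₃).Equivalent (Q₁.prod (Q₂.prod Q₃)) :=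
  ⟨{ LinearEquiv.prodAssoc F V₁ V₂ V₃ with
    map_app' := fun m => by simp [add_assoc] }⟩

theorem equivalent_zero_prod [Subsingleton V₁] (Q₁ : QuadraticForm F V₁)
    (Q₂ : QuadraticForm F V₂) : (Q₁.prod Q₂).Equivalent Q₂ :=
  ⟨{ toFun := Prod.snd
     invFun := fun v => (0, v)
     left_inv := fun v => Prod.ext (Subsingleton.elim _ _) rfl
     right_inv := fun _ => rfl
     map_add' := fun _ _ => rfl
     map_smul' := fun _ _ => rfl
     map_app' := fun m => by
      have : m.1 = 0 := Subsingleton.elim _ _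
      simp [this] }⟩

theorem equivalent_of_subsingleton [Subsingleton V₁] [Subsingleton V₂] (Q₁ : QuadraticForm F V₁)
    (Q₂ : QuadraticForm F V₂) : Q₁.Equivalent Q₂ :=
  ⟨{ (0 : V₁ ≃ₗ[F] V₂) with
    map_app' := fun m => by
      have : m = 0 := Subsingleton.elim _ _
      simp [this] }⟩

theorem equivalent_prod_tmul [Invertible (2 : F)] (Q₁ : QuadraticForm F V₁) (Q₂ : QuadraticForm F V₂)
    (Q₃ : QuadraticForm F V₃) :
    (QuadraticForm.tmul (Q₁.prod Q₂) Q₃).Equivalent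
      ((QuadraticForm.tmul Q₁ Q₃).prod (QuadraticForm.tmul Q₂ Q₃)) := by
  refine ⟨{ TensorProduct.prodLeft F F V₁ V₂ V₃ with map_app' := fun m => ?_ }⟩
  suffices h : ((QuadraticForm.tmul Q₁ Q₃).prod (QuadraticForm.tmul Q₂ Q₃)).comp
      (TensorProduct.prodLeft F F V₁ V₂ V₃).toLinearMap =
      QuadraticForm.tmul (Q₁.prod Q₂) Q₃ from DFunLike.congr_fun h m
  refine (QuadraticMap.associated_rightInverse F).injective ?_
  ext <;> simp [QuadraticForm.associated_tmul, QuadraticMap.associated_comp]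

end Isometries

namespace IsoClass

variable {F : Type u} [Field F]

/-- The isometry class of a quadratic space. -/
def mk (S : QuadSpace F) : IsoClass F := Quotient.mk _ S

theorem mk_eq {S T : QuadSpace F} (h : S.form.Equivalent T.form) : mk S = mk T := Quotient.sound h

variable [Invertible (2 : F)]

instance : Zero (IsoClass F) := ⟨mk (.zero F)⟩
instance : One (IsoClass F) := ⟨mk (.one F)⟩
instance : Add (IsoClass F) :=
  ⟨Quotient.map₂ QuadSpace.add fun _ _ h _ _ h' => QuadraticMap.Equivalent.prod h h'⟩
instance : Mul (IsoClass F) :=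
  ⟨Quotient.map₂ QuadSpace.mul fun _ _ h _ _ h' => equivalent_tmul h h'⟩

theorem add_comm' (a b : IsoClass F) : a + b = b + a := by
  induction a, b using Quotient.inductionOn₂ with
  | h S T => exact mk_eq ⟨QuadraticMap.IsometryEquiv.prodComm S.form T.form⟩

theorem mul_comm' (a b : IsoClass F) : a * b = b * a := by
  induction a, b using Quotient.inductionOn₂ with
  | h S T => exact mk_eq ⟨QuadraticForm.tensorComm S.form T.form⟩

theorem zero_add' (a : IsoClass F) : 0 + a = a := by
  induction a using Quotient.inductionOn with
  | h S =>
      exact mk_eq (S := (QuadSpace.zero F).add S)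
        (equivalent_zero_prod (V₁ := PUnit) 0 S.form)

theorem zero_mul' (a : IsoClass F) : 0 * a = 0 := by
  induction a using Quotient.inductionOn with
  | h S =>
      have h0 : Subsingleton (QuadSpace.zero F).carrier := inferInstanceAs (Subsingleton PUnit)
      have h1 : Subsingleton ((QuadSpace.zero F).mul S).carrier :=
        inferInstanceAs (Subsingleton ((QuadSpace.zero F).carrier ⊗[F] S.carrier))
      exact mk_eq (S := (QuadSpace.zero F).mul S) (equivalent_of_subsingleton _ _)

theorem one_mul' (a : IsoClass F) : 1 * a = a := by
  induction a using Quotient.inductionOn with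
  | h S => exact mk_eq (S := (QuadSpace.one F).mul S) ⟨QuadraticForm.tensorLId S.form⟩

theorem add_mul' (a b c : IsoClass F) : (a + b) * c = a * c + b * c := by
  induction a, b, c using Quotient.inductionOn₃ with
  | h S T U =>
      exact mk_eq (S := (S.add T).mul U) (T := (S.mul U).add (T.mul U))
        (equivalent_prod_tmul S.form T.form U.form)

/-- The semiring of isometry classes, under orthogonal sum and tensor product. -/
instance : CommSemiring (IsoClass F) where
  nsmul := nsmulRec
  add_comm := add_comm'
  mul_comm := mul_comm'
  zero_add := zero_add'
  add_zero a := by rw [add_comm', zero_add']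
  zero_mul := zero_mul'
  mul_zero a := by rw [mul_comm', zero_mul']
  one_mul := one_mul'
  mul_one a := by rw [mul_comm', one_mul']
  add_assoc a b c := by
    induction a, b, c using Quotient.inductionOn₃ with
    | h S T U =>
      exact mk_eq (S := (S.add T).add U) (T := S.add (T.add U))
        (equivalent_prod_assoc S.form T.form U.form)
  mul_assoc a b c := by
    induction a, b, c using Quotient.inductionOn₃ with
    | h S T U =>
      exact mk_eq (S := (S.mul T).mul U) (T := S.mul (T.mul U))
        ⟨QuadraticForm.tensorAssoc S.form T.form U.form⟩
  right_distrib := add_mul'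
  left_distrib a b c := by rw [mul_comm', add_mul', mul_comm' b, mul_comm' c]

end IsoClass

/-- The Grothendieck-Witt ring: the Grothendieck group of the monoid of isometry classes of regular
quadratic spaces under orthogonal sum, with the multiplication induced by tensor product. -/
def GW (F : Type u) [Field F] [Invertible (2 : F)] : Type (u + 1) :=
  Algebra.GrothendieckAddGroup (IsoClass F)

namespace GW

variable {F : Type u} [Field F] [Invertible (2 : F)]

instance : AddCommGroup (GW F) :=
  inferInstanceAs (AddCommGroup (Algebra.GrothendieckAddGroup (IsoClass F)))

/-- The class of an honest form in `GW F`, as an additive map. -/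
def of : IsoClass F →+ GW F := Algebra.GrothendieckAddGroup.of

/-- The universal property of the Grothendieck group. -/
def lift {A : Type*} [AddCommGroup A] (f : IsoClass F →+ A) : GW F →+ A :=
  Algebra.GrothendieckAddGroup.lift f

@[simp]
theorem lift_of {A : Type*} [AddCommGroup A] (f : IsoClass F →+ A) (a : IsoClass F) :
    lift f (of a) = f a :=
  DFunLike.congr_fun (Algebra.GrothendieckAddGroup.lift.left_inv f) a

theorem exists_of_sub_of (x : GW F) : ∃ a b : IsoClass F, x = of a - of b := by
  induction x using AddLocalization.ind with
  | H y =>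
    refine ⟨y.1, y.2, ?_⟩
    change AddLocalization.mk y.1 y.2 =
      (AddLocalization.mk y.1 0 : Algebra.GrothendieckAddGroup (IsoClass F)) -
        (AddLocalization.mk y.2.1 0 : Algebra.GrothendieckAddGroup (IsoClass F))
    rw [Algebra.GrothendieckAddGroup.mk_sub_mk]
    congr 1
    · exact (add_zero _).symm
    · exact Subtype.ext (zero_add _).symm

/-- The multiplication of `GW F` as a biadditive map. -/
def mulHom : GW F →+ GW F →+ GW F :=
  lift
    { toFun := fun a => lift (of.comp (AddMonoidHom.mulLeft a))
      map_zero' := by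
        ext x
        obtain ⟨a, b, rfl⟩ := exists_of_sub_of x
        simp
      map_add' := fun c d => by
        ext x
        obtain ⟨a, b, rfl⟩ := exists_of_sub_of x
        simp [add_mul]
        abel }

instance : Mul (GW F) := ⟨fun x y => mulHom x y⟩
instance : One (GW F) := ⟨of 1⟩

theorem mul_def (x y : GW F) : x * y = mulHom x y := rfl

@[simp]
theorem of_mul_of (a b : IsoClass F) : of a * of b = of (a * b) := by
  simp [mul_def, mulHom]

theorem left_distrib' (x y z : GW F) : x * (y + z) = x * y + x * z := by simp [mul_def]
theorem right_distrib' (x y z : GW F) : (x + y) * z = x * z + y * z := by simp [mul_def]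
theorem mul_sub' (x y z : GW F) : x * (y - z) = x * y - x * z := by simp [mul_def]
theorem sub_mul' (x y z : GW F) : (x - y) * z = x * z - y * z := by simp [mul_def]

theorem mul_comm' (x y : GW F) : x * y = y * x := by
  obtain ⟨a, b, rfl⟩ := exists_of_sub_of x
  obtain ⟨c, d, rfl⟩ := exists_of_sub_of y
  simp only [mul_sub', sub_mul', of_mul_of, mul_comm]
  abel

theorem one_mul' (x : GW F) : 1 * x = x := by
  obtain ⟨a, b, rfl⟩ := exists_of_sub_of x
  change of 1 * _ = _
  simp only [mul_sub', of_mul_of, one_mul]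

instance : CommRing (GW F) where
  __ := (inferInstance : AddCommGroup (GW F))
  left_distrib := left_distrib'
  right_distrib := right_distrib'
  zero_mul x := by simp [mul_def]
  mul_zero x := by simp [mul_def]
  mul_assoc x y z := by
    obtain ⟨a, b, rfl⟩ := exists_of_sub_of x
    obtain ⟨c, d, rfl⟩ := exists_of_sub_of y
    obtain ⟨e, f, rfl⟩ := exists_of_sub_of z
    simp only [mul_sub', sub_mul', of_mul_of, mul_assoc]
  one_mul := one_mul'
  mul_one x := by rw [mul_comm', one_mul']
  mul_comm := mul_comm'

end GW

/-! ### Scharlau transfer -/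

section Transfer

variable {F E : Type u} [Field F] [Field E] [Algebra F E] [Invertible (2 : F)] [Invertible (2 : E)]

theorem associated_comp {V : Type*} [AddCommGroup V] [Module F V] [Module E V]
    [IsScalarTower F E V] (s : E →ₗ[F] F) (Q : QuadraticForm E V) (x y : V) :
    QuadraticMap.associated (s.compQuadraticMap' Q) x y = s (QuadraticMap.associated Q x y) := by
  have hF := congr($(QuadraticMap.two_nsmul_associated F (s.compQuadraticMap' Q)) x y)
  have hE := congr($(QuadraticMap.two_nsmul_associated E Q) x y)
  simp only [LinearMap.smul_apply, QuadraticMap.polarBilin_apply_apply] at hF hE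
  rw [LinearMap.compQuadraticMap_polar, ← hE, map_nsmul, nsmul_eq_mul, nsmul_eq_mul] at hF
  exact mul_left_cancel₀ (Invertible.ne_zero ((2 : ℕ) : F)) hF

theorem nondegenerate_comp {V : Type*} [AddCommGroup V] [Module F V] [Module E V]
    [IsScalarTower F E V] {s : E →ₗ[F] F} (hs : s ≠ 0) {Q : QuadraticForm E V}
    (h : Q.Nondegenerate) : (s.compQuadraticMap' Q).Nondegenerate := by
  rw [nondegenerate_iff] at *
  intro x hx
  refine h x fun y => ?_
  by_contra hne
  apply hs
  ext c
  have := hx ((c / QuadraticMap.associated Q x y) • y)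
  rw [associated_comp, map_smul, smul_eq_mul, div_mul_cancel₀ _ hne] at this
  simpa using this

/-- The underlying `F`-vector space structure of an `E`-quadratic space. -/
abbrev QuadSpace.restrictModule (F : Type u) {E : Type u} [Field F] [Field E] [Algebra F E]
    (S : QuadSpace E) : Module F S.carrier :=
  Module.compHom S.carrier (algebraMap F E)

theorem QuadSpace.restrictModule_tower (F : Type u) {E : Type u} [Field F] [Field E] [Algebra F E]
    (S : QuadSpace E) : letI := S.restrictModule F; IsScalarTower F E S.carrier :=
  letI := S.restrictModule F
  IsScalarTower.of_algebraMap_smul fun _ _ => rfl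

variable (F) in
/-- The transfer of an `E`-quadratic space along a nonzero functional `s : E → F`: the form
`v ↦ s (φ v)` on the underlying `F`-vector space. -/
def QuadSpace.transfer [FiniteDimensional F E] (s : E →ₗ[F] F) (hs : s ≠ 0) (S : QuadSpace E) :
    QuadSpace F :=
  letI := S.restrictModule F
  haveI := S.restrictModule_tower F
  { carrier := S.carrier
    finite := Module.Finite.trans E S.carrier
    form := s.compQuadraticMap' S.form
    regular := nondegenerate_comp hs S.regular }

/-- The transfer on isometry classes. -/
def IsoClass.transfer [FiniteDimensional F E] (s : E →ₗ[F] F) (hs : s ≠ 0) :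
    IsoClass E →+ IsoClass F where
  toFun := Quotient.map (QuadSpace.transfer F s hs) fun S T h => by
    obtain ⟨e⟩ := h
    exact ⟨{ toFun := fun v => e v
             invFun := fun v => e.symm v
             left_inv := fun v => e.symm_apply_apply v
             right_inv := fun v => e.apply_symm_apply v
             map_add' := fun v w => map_add e v w
             map_smul' := fun c v => e.map_smul' (algebraMap F E c) v
             map_app' := fun m => congrArg s (e.map_app m) }⟩
  map_zero' := by
    have h0 : Subsingleton (QuadSpace.zero F).carrier := inferInstanceAs (Subsingleton PUnit)
    have h1 : Subsingleton ((QuadSpace.zero E).transfer F s hs).carrier :=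
      inferInstanceAs (Subsingleton PUnit)
    exact IsoClass.mk_eq (S := (QuadSpace.zero E).transfer F s hs)
      (equivalent_of_subsingleton _ _)
  map_add' a b := by
    induction a, b using Quotient.inductionOn₂ with
    | h S T =>
      exact IsoClass.mk_eq (S := (S.add T).transfer F s hs)
        (T := (S.transfer F s hs).add (T.transfer F s hs))
        ⟨{ toFun := fun v => v
           invFun := fun v => v
           left_inv := fun _ => rfl
           right_inv := fun _ => rfl
           map_add' := fun _ _ => rfl
           map_smul' := fun _ _ => rfl
           map_app' := fun m => (map_add s (S.form m.1) (T.form m.2)).symm }⟩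

/-- The Scharlau transfer `s_* : GW E → GW F`. -/
def transfer [FiniteDimensional F E] (s : E →ₗ[F] F) (hs : s ≠ 0) : GW E →+ GW F :=
  GW.lift (GW.of.comp (IsoClass.transfer s hs))

end Transfer

/-! ### Rank, signed discriminant, binary forms -/

section Invariants

variable {F : Type u} [Field F]

variable (F) in
/-- The group of square classes `Fˣ / (Fˣ)²`. -/
def SquareClass : Type u := Fˣ ⧸ (powMonoidHom 2 : Fˣ →* Fˣ).range

instance : CommGroup (SquareClass F) :=
  inferInstanceAs (CommGroup (Fˣ ⧸ (powMonoidHom 2 : Fˣ →* Fˣ).range))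

variable (F) in
/-- The projection `Fˣ → Fˣ / (Fˣ)²`. -/
def squareClass : Fˣ →* SquareClass F := QuotientGroup.mk' (powMonoidHom 2 : Fˣ →* Fˣ).range

variable [Invertible (2 : F)]

/-- The matrix of a quadratic form `Q` in the basis `b`: the symmetric matrix `A` with
`Q (∑ xᵢ bᵢ) = xᵀ A x`. -/
abbrev gram {V ι : Type*} [AddCommGroup V] [Module F V] [Fintype ι] [DecidableEq ι]
    (Q : QuadraticForm F V) (b : Module.Basis ι F V) : Matrix ι ι F :=
  LinearMap.BilinForm.toMatrix b (QuadraticMap.associated Q)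

theorem det_gram_ne_zero {V ι : Type*} [AddCommGroup V] [Module F V] [Fintype ι] [DecidableEq ι]
    {Q : QuadraticForm F V} (h : Q.Nondegenerate) (b : Module.Basis ι F V) :
    (gram Q b).det ≠ 0 := by
  rw [← Matrix.nondegenerate_iff_det_ne_zero, LinearMap.BilinForm.nondegenerate_toMatrix_iff]
  exact QuadraticMap.nondegenerate_associated_iff.2 h

/-- The determinant of a regular quadratic space in a given basis, as a unit. -/
def QuadSpace.detUnit (S : QuadSpace F) {ι : Type*} [Fintype ι] [DecidableEq ι]
    (b : Module.Basis ι F S.carrier) : Fˣ :=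
  Units.mk0 (gram S.form b).det (det_gram_ne_zero S.regular b)

theorem QuadSpace.squareClass_detUnit (S T : QuadSpace F) (h : S.form.Equivalent T.form)
    {ι κ : Type*} [Fintype ι] [DecidableEq ι] [Fintype κ] [DecidableEq κ]
    (b : Module.Basis ι F S.carrier) (c : Module.Basis κ F T.carrier) :
    squareClass F (S.detUnit b) = squareClass F (T.detUnit c) := by
  obtain ⟨e⟩ := h
  have e1 : ι ≃ κ := (b.map e.toLinearEquiv).indexEquiv c
  set c' : Module.Basis ι F T.carrier := c.reindex e1.symm with hc'
  set b' : Module.Basis ι F T.carrier := b.map e.toLinearEquiv with hb'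
  have h1 : (gram T.form c).det = (gram T.form c').det := by
    have : gram T.form c' = (gram T.form c).submatrix e1 e1 := by
      ext i j
      simp [gram, hc']
    rw [this, Matrix.det_submatrix_equiv_self]
  have h2 : gram S.form b = gram T.form b' := by
    ext i j
    have hQ : T.form.comp e.toLinearEquiv.toLinearMap = S.form :=
      QuadraticMap.ext fun v => e.map_app v
    simp [gram, LinearMap.BilinForm.toMatrix_apply, hb', ← hQ, QuadraticMap.associated_comp]
  have h3 := LinearMap.BilinForm.toMatrix_mul_basis_toMatrix b' c' (QuadraticMap.associated T.form)
  have h4 : (gram T.form c).det = (gram S.form b).det * (b'.toMatrix c').det ^ 2 := by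
    rw [h1, h2, gram, gram, ← h3, Matrix.det_mul, Matrix.det_mul, Matrix.det_transpose]
    ring
  have h5 : (b'.toMatrix c').det ≠ 0 := by
    intro h0
    rw [h0] at h4
    exact det_gram_ne_zero T.regular c (by simpa using h4)
  refine QuotientGroup.eq.2 ⟨Units.mk0 _ h5, ?_⟩
  rw [eq_inv_mul_iff_mul_eq]
  ext
  simp [QuadSpace.detUnit, h4]

/-- The determinant, as a square class, of a regular quadratic space. -/
def QuadSpace.det (S : QuadSpace F) : SquareClass F :=
  squareClass F (S.detUnit (Module.finBasis F S.carrier))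

/-- Rank of isometry classes. -/
def IsoClass.rank : IsoClass F →+ ℤ where
  toFun := Quotient.lift (fun S => (Module.finrank F S.carrier : ℤ)) fun S T h => by
    obtain ⟨e⟩ := h
    exact congrArg _ e.toLinearEquiv.finrank_eq
  map_zero' := by
    have h0 : Subsingleton (QuadSpace.zero F).carrier := inferInstanceAs (Subsingleton PUnit)
    exact congrArg _ (Module.finrank_zero_of_subsingleton (M := (QuadSpace.zero F).carrier))
  map_add' a b := by
    induction a, b using Quotient.inductionOn₂ with
    | h S T =>
      exact (congrArg (Nat.cast (R := ℤ))
        (Module.finrank_prod (R := F) (M := S.carrier) (M' := T.carrier))).trans (Nat.cast_add _ _)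

/-- Determinant of isometry classes. -/
def IsoClass.det : IsoClass F →+ Additive (SquareClass F) where
  toFun := Quotient.lift (fun S => Additive.ofMul S.det) fun S T h =>
    congrArg _ (S.squareClass_detUnit T h _ _)
  map_zero' := by
    have h0 : Subsingleton (QuadSpace.zero F).carrier := inferInstanceAs (Subsingleton PUnit)
    change squareClass F _ = 1
    rw [(QuadSpace.zero F).squareClass_detUnit _ (.refl _) _ (Module.Basis.empty (ι := Fin 0) _)]
    rw [← map_one (squareClass F)]
    congr 1
    ext
    simp [QuadSpace.detUnit]
  map_add' a b := by
    induction a, b using Quotient.inductionOn₂ with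
    | h S T =>
      change squareClass F _ = squareClass F _ * squareClass F _
      rw [(S.add T).squareClass_detUnit _ (.refl _) _
        ((Module.finBasis F S.carrier).prod (Module.finBasis F T.carrier)), ← map_mul]
      congr 1
      ext
      simp only [QuadSpace.detUnit, Units.val_mk0, Units.val_mul]
      rw [← Matrix.det_fromBlocks_zero₂₁ _ 0]
      congr 1
      ext (i | i) (j | j) <;>
        simp [QuadSpace.add, LinearMap.BilinForm.toMatrix_apply, Matrix.fromBlocks]

/-- The (virtual) dimension. -/
def rank : GW F →+ ℤ := GW.lift IsoClass.rank

/-- The determinant in square classes, extended additively to virtual forms. -/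
def det : GW F →+ Additive (SquareClass F) := GW.lift IsoClass.det

/-- The signed discriminant `δ±(φ) = (-1)^(n(n-1)/2) det φ`, where `n` is the virtual dimension. -/
def signedDisc (φ : GW F) : SquareClass F :=
  squareClass F (-1) ^ (rank φ * (rank φ - 1) / 2) * (det φ).toMul

/-- The diagonal binary form `⟨a, b⟩`, i.e. `a x² + b y²`, as a quadratic space. -/
def QuadSpace.binary (a b : Fˣ) : QuadSpace F where
  carrier := Fin 2 → F
  form := QuadraticMap.weightedSumSquares F ![(a : F), (b : F)]
  regular := by
    have : NeZero (2 : F) := ⟨Invertible.ne_zero 2⟩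
    rw [QuadraticMap.nondegenerate_iff_radical_eq_bot, QuadraticForm.radical_weightedSumSquares]
    ext v
    simp [Pi.mem_spanSubset_iff, Fin.forall_fin_two, funext_iff]

/-- The class of `⟨a, b⟩` in `GW F`. -/
def binary (a b : Fˣ) : GW F := GW.of (IsoClass.mk (QuadSpace.binary a b))

/-- `D(q)`, the set of nonzero values of `q`. -/
def valueSet {F V : Type*} [Field F] [AddCommGroup V] [Module F V] (q : QuadraticForm F V) :
    Set Fˣ :=
  {a | ∃ v : V, q v = a}

/-- `[D(q)²]`, the subgroup of `Fˣ` generated by the products of two elements of `D(q)`. -/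
def valueSqGroup {F V : Type*} [Field F] [AddCommGroup V] [Module F V] (q : QuadraticForm F V) :
    Subgroup Fˣ :=
  Subgroup.closure {c | ∃ a ∈ valueSet q, ∃ b ∈ valueSet q, c = a * b}

end Invariants

/-! ### The transfer ideal of a scheme -/

section Frobenius

variable {F E : Type u} [Field F] [Field E] [Algebra F E] [Invertible (2 : F)] [Invertible (2 : E)]

/-- The tensor product over `F` of an `E`-quadratic space and an `F`-quadratic space, as an
`E`-quadratic space. -/
def QuadSpace.mulBase (S : QuadSpace E) (T : QuadSpace F) : QuadSpace E :=
  letI := S.restrictModule F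
  haveI := S.restrictModule_tower F
  { carrier := S.carrier ⊗[F] T.carrier
    finite := Module.Finite.equiv
      (TensorProduct.AlgebraTensorModule.cancelBaseChange F E E S.carrier T.carrier)
    form := QuadraticForm.tmul S.form T.form
    regular := nondegenerate_tmul S.regular T.regular }

theorem IsoClass.transfer_mk_mul [FiniteDimensional F E] (s : E →ₗ[F] F) (hs : s ≠ 0)
    (S : QuadSpace E) (T : QuadSpace F) :
    IsoClass.transfer s hs (.mk S) * .mk T = IsoClass.transfer s hs (.mk (S.mulBase T)) := by
  refine IsoClass.mk_eq (S := (S.transfer F s hs).mul T)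
    (T := (S.mulBase T).transfer F s hs) ?_
  let := S.restrictModule F
  have := S.restrictModule_tower F
  have h : QuadraticForm.tmul (s.compQuadraticMap' S.form) T.form =
      s.compQuadraticMap' (QuadraticForm.tmul S.form T.form) := by
    refine (QuadraticMap.associated_rightInverse F).injective ?_
    ext v w v' w'
    simp [QuadraticForm.associated_tmul, associated_comp]
  exact ⟨{ toFun := fun v => v
           invFun := fun v => v
           left_inv := fun _ => rfl
           right_inv := fun _ => rfl
           map_add' := fun _ _ => rfl
           map_smul' := fun c v =>
             (algebraMap_smul E c (show S.carrier ⊗[F] T.carrier from v)).symm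
           map_app' := fun m => (DFunLike.congr_fun h m).symm }⟩

/-- Images of Scharlau transfers are stable under multiplication (Frobenius reciprocity). -/
theorem mul_mem_range_transfer [FiniteDimensional F E] (s : E →ₗ[F] F) (hs : s ≠ 0)
    (c φ : GW F) (h : φ ∈ (transfer s hs).range) : c * φ ∈ (transfer s hs).range := by
  have key : ∀ (a : IsoClass E) (b : IsoClass F),
      GW.of b * transfer s hs (GW.of a) ∈ (transfer s hs).range := by
    intro a b
    induction a using Quotient.inductionOn with
    | h S =>
      induction b using Quotient.inductionOn with
      | h T =>
        refine ⟨GW.of (.mk (S.mulBase T)), ?_⟩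
        change transfer s hs (GW.of _) = GW.of (.mk T) * transfer s hs (GW.of (.mk S))
        simp only [transfer, GW.lift_of, AddMonoidHom.comp_apply, ← IsoClass.transfer_mk_mul]
        rw [GW.of_mul_of, mul_comm]
  obtain ⟨ψ, rfl⟩ := h
  obtain ⟨a, b, rfl⟩ := GW.exists_of_sub_of ψ
  obtain ⟨d, e, rfl⟩ := GW.exists_of_sub_of c
  rw [map_sub, mul_sub, sub_mul, sub_mul]
  exact sub_mem (sub_mem (key _ _) (key _ _)) (sub_mem (key _ _) (key _ _))

end Frobenius

open AlgebraicGeometry CategoryTheory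

section Schemes

variable (k : Type u) [Field k]

/-- The residue field of a point of a `k`-scheme, as an extension of `k`. -/
def ResidueField (X : Scheme.{u}) [X.Over (Spec (.of k))] (x : X) : Type u := X.residueField x

instance (X : Scheme.{u}) [X.Over (Spec (.of k))] (x : X) : Field (ResidueField k X x) :=
  inferInstanceAs (Field (X.residueField x))

/-- The `k`-algebra structure given by `Spec κ(x) ⟶ X ⟶ Spec k`. -/
instance (X : Scheme.{u}) [X.Over (Spec (.of k))] (x : X) : Algebra k (ResidueField k X x) :=
  (Spec.preimage (X.fromSpecResidueField x ≫ (X ↘ Spec (.of k)))).hom.toAlgebra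

instance [Invertible (2 : k)] (X : Scheme.{u}) [X.Over (Spec (.of k))] (x : X) :
    Invertible (2 : ResidueField k X x) :=
  (Invertible.map (algebraMap k (ResidueField k X x)) 2).copy 2 (map_ofNat _ _).symm

theorem finite_residueField (X : Scheme.{u}) [X.Over (Spec (.of k))]
    [LocallyOfFiniteType (X ↘ Spec (.of k))] {x : X} (hx : IsClosed {x}) :
    FiniteDimensional k (ResidueField k X x) := by
  have : IsFinite (X.fromSpecResidueField x ≫ (X ↘ Spec (.of k))) := by
    rw [isClosed_singleton_iff_isClosedImmersion] at hx
    rw [isFinite_iff_locallyOfFiniteType_of_jacobsonSpace]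
    infer_instance
  rw [← Spec.map_preimage (X.fromSpecResidueField x ≫ (X ↘ Spec (.of k))),
    IsFinite.SpecMap_iff] at this
  exact this

variable {k} [Invertible (2 : k)]

/-- The transfer ideal of `X`: the sum over the closed points `x` of `X` of the images of the
Scharlau transfers `(s_x)_* : GW κ(x) → GW k`, for chosen nonzero `k`-linear functionals
`s_x : κ(x) → k`. -/
def transferIdeal (X : Scheme.{u}) [X.Over (Spec (.of k))]
    [LocallyOfFiniteType (X ↘ Spec (.of k))]
    (s : ∀ x : X, ResidueField k X x →ₗ[k] k) (hs : ∀ x : X, IsClosed {x} → s x ≠ 0) :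
    Ideal (GW k) :=
  let A : AddSubgroup (GW k) := ⨆ x : {x : X // IsClosed {x}},
    haveI := finite_residueField k X x.2
    (transfer (s x) (hs x x.2)).range
  { A with
    smul_mem' := fun c φ hφ => by
      change φ ∈ A at hφ
      change c * φ ∈ A
      induction hφ using AddSubgroup.iSup_induction' with
      | hp x φ hφ =>
        have := finite_residueField k X x.2
        exact AddSubgroup.mem_iSup_of_mem x (mul_mem_range_transfer _ _ c φ hφ)
      | h1 => simp
      | hadd φ ψ _ _ h h' => rw [mul_add]; exact add_mem h h' }

end Schemes

/-! ### Projective quadrics -/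

section Quadric

variable {k : Type u} [Field k] [Invertible (2 : k)] {n : ℕ}

open MvPolynomial

/-- The homogeneous polynomial `∑ Aᵢⱼ Xᵢ Xⱼ` of a quadratic form with symmetric matrix `A`. -/
def quadricPoly (q : QuadraticForm k (Fin n → k)) : MvPolynomial (Fin n) k :=
  ∑ i, ∑ j, C (q.toMatrix' i j) * X i * X j

theorem quadricPoly_isHomogeneous (q : QuadraticForm k (Fin n → k)) :
    (quadricPoly q).IsHomogeneous 2 := by
  unfold quadricPoly
  refine IsHomogeneous.sum _ _ _ fun i _ => IsHomogeneous.sum _ _ _ fun j _ => ?_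
  exact ((isHomogeneous_C _ _).mul (isHomogeneous_X _ i)).mul (isHomogeneous_X _ j)

/-- The homogeneous coordinate ring `k[x₁, …, xₙ] / (q)`. -/
abbrev CoordRing (q : QuadraticForm k (Fin n → k)) : Type u :=
  MvPolynomial (Fin n) k ⧸ Ideal.span {quadricPoly q}

/-- The grading of the homogeneous coordinate ring by degree. -/
def coordGrading (q : QuadraticForm k (Fin n → k)) (d : ℕ) : Submodule k (CoordRing q) :=
  (homogeneousSubmodule (Fin n) k d).map (Ideal.Quotient.mkₐ k _).toLinearMap

theorem mk_mem_coordGrading (q : QuadraticForm k (Fin n → k)) {d : ℕ} {p : MvPolynomial (Fin n) k}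
    (hp : p.IsHomogeneous d) : (Ideal.Quotient.mk _ p : CoordRing q) ∈ coordGrading q d :=
  ⟨p, hp, rfl⟩

instance (q : QuadraticForm k (Fin n → k)) : SetLike.GradedMonoid (coordGrading q) where
  one_mem := mk_mem_coordGrading q (isHomogeneous_one _ _)
  mul_mem := by
    rintro i j _ _ ⟨a, ha, rfl⟩ ⟨b, hb, rfl⟩
    exact mk_mem_coordGrading q (IsHomogeneous.mul ha hb)

theorem coordGrading_isInternal (q : QuadraticForm k (Fin n → k)) :
    DirectSum.IsInternal (coordGrading q) := by
  let : GradedAlgebra (homogeneousSubmodule (Fin n) k) := MvPolynomial.gradedAlgebra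
  let f : ∀ d, homogeneousSubmodule (Fin n) k d →ₗ[k] coordGrading q d := fun d =>
    (Ideal.Quotient.mkₐ k (Ideal.span {quadricPoly q})).toLinearMap.submoduleMap
      (homogeneousSubmodule (Fin n) k d)
  have hf : Function.Surjective (DirectSum.lmap f) :=
    DirectSum.lmap_surjective f |>.2 fun d => LinearMap.submoduleMap_surjective _ _
  have hcomm : ∀ y, DirectSum.coeAddMonoidHom (coordGrading q) (DirectSum.lmap f y) =
      Ideal.Quotient.mk _ (DirectSum.coeAddMonoidHom (homogeneousSubmodule (Fin n) k) y) := by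
    intro y
    induction y using DirectSum.induction_on with
    | zero => simp only [map_zero]
    | of i x =>
      rw [DirectSum.lmap_of, DirectSum.coeAddMonoidHom_of, DirectSum.coeAddMonoidHom_of]
      rfl
    | add x y hx hy => simp only [map_add, hx, hy]
  have hhom : (Ideal.span {quadricPoly q}).IsHomogeneous (homogeneousSubmodule (Fin n) k) :=
    Ideal.homogeneous_span _ _ fun x hx => by
      rw [Set.mem_singleton_iff.1 hx]
      exact ⟨2, quadricPoly_isHomogeneous q⟩
  constructor
  · rw [injective_iff_map_eq_zero]
    intro x hx
    obtain ⟨y, rfl⟩ := hf x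
    rw [hcomm, Ideal.Quotient.eq_zero_iff_mem] at hx
    have hy : DirectSum.decompose (homogeneousSubmodule (Fin n) k)
        (DirectSum.coeAddMonoidHom (homogeneousSubmodule (Fin n) k) y) = y :=
      DirectSum.Decomposition.right_inv y
    refine DFinsupp.ext fun i => Subtype.ext ?_
    have h := hhom i hx
    rw [hy] at h
    exact Ideal.Quotient.eq_zero_iff_mem.2 h
  · intro a
    obtain ⟨p, rfl⟩ := Ideal.Quotient.mk_surjective a
    refine ⟨DirectSum.lmap f (DirectSum.decompose (homogeneousSubmodule (Fin n) k) p), ?_⟩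
    rw [hcomm]
    exact congrArg _ (DirectSum.Decomposition.left_inv p)

instance (q : QuadraticForm k (Fin n → k)) : GradedAlgebra (coordGrading q) where
  __ := (coordGrading_isInternal q).chooseDecomposition

/-- The projective quadric `q = 0` in `ℙⁿ⁻¹`, of dimension `n - 2`. -/
def quadric (q : QuadraticForm k (Fin n → k)) : Scheme.{u} := Proj (coordGrading q)

instance (q : QuadraticForm k (Fin n → k)) : (quadric q).Over (Spec (.of k)) where
  hom := Proj.toSpecZero (coordGrading q) ≫
    Spec.map (CommRingCat.ofHom (algebraMap k (coordGrading q 0)))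

theorem algebraMap_coordGrading_surjective (q : QuadraticForm k (Fin n → k)) :
    Function.Surjective (algebraMap k (coordGrading q 0)) := by
  rintro ⟨_, p, hp, rfl⟩
  refine ⟨p.coeff 0, Subtype.ext ?_⟩
  have h := homogeneousComponent_eq_self hp
  rw [homogeneousComponent_zero] at h
  exact congrArg (Ideal.Quotient.mk (Ideal.span {quadricPoly q})) h

instance (q : QuadraticForm k (Fin n → k)) :
    LocallyOfFiniteType (quadric q ↘ Spec (.of k)) := by
  have h0 : IsScalarTower k (coordGrading q 0) (CoordRing q) :=
    ⟨fun c x a => smul_mul_assoc c (x : CoordRing q) a⟩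
  have h1 : Algebra.FiniteType (coordGrading q 0) (CoordRing q) :=
    .of_restrictScalars_finiteType k _ _
  have h2 : LocallyOfFiniteType
      (Spec.map (CommRingCat.ofHom (algebraMap k (coordGrading q 0)))) := by
    rw [HasRingHomProperty.Spec_iff (P := @LocallyOfFiniteType)]
    exact RingHom.FiniteType.of_surjective _ (algebraMap_coordGrading_surjective q)
  exact inferInstanceAs (LocallyOfFiniteType (Proj.toSpecZero (coordGrading q) ≫ Spec.map _))

end Quadric

end

end GWTransfer

/-! If `q` is isotropic, `Q` has a rational point, the transfer ideal is all of `GW k`, and `q`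
takes every value, so both claims are trivial. Let `q` be anisotropic. A finite extension of `k`
over which `q` becomes isotropic contains the residue field of a closed point of `Q`, and `q` is
isotropic over each of these residue fields; they are separable because `k` is perfect.

Upper bound on the ideal: by Springer's theorem (`even_finrank_of_hasZero`) all residue degrees are
even. On virtual forms of even rank the signed discriminant is a homomorphism, so it suffices to
treat transfers of unary forms. A functional is a multiple of the trace, and the discriminant of a
power basis is a signed norm; hence the signed discriminant of such a transfer is a norm
(`signedDisc_transfer_unary`). Knebusch's norm principle (`norm_mem_matrixValueSqGroup`) puts norms
in `[D(q)²]`. This gives claim 1, and the forward half of claim 2 since `δ±⟨a, b⟩ = -ab`.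

Lower bound: for orthogonal `v, w`, the vector `θv + w` is isotropic over `k(θ)` with `θ² =
-q(w)/q(v)`. This is the residue field of a point of degree 2, and its transfers contain multiples
of `⟨1, -N⟩` for the norms `N = r² + q(w)/q(v)`, which is `q(v) q(rv + w)` up to squares. So `⟨1,
-c⟩` lies in the ideal for all generators `c` of `[D(q)²]`, then for the whole group
(`unary_one_add_unary_neg_mem`). Multiplying by `⟨a⟩` with `c = -ab` gives `⟨a, b⟩`. -/

namespace GWTransfer

/-! ### Springer's theorem and Knebusch's norm principle. -/

section Values

open Polynomial

variable {ι K : Type*} [Fintype ι] [Field K]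

/-- The value `∑ Aᵢⱼ vᵢ vⱼ` at a vector with entries in a `K`-algebra. -/
def matrixValue (A : Matrix ι ι K) {R : Type*} [CommRing R] [Algebra K R] (v : ι → R) : R :=
  ∑ i, ∑ j, algebraMap K R (A i j) * v i * v j

/-- The quadratic form with matrix `A` has a nontrivial zero over the `K`-algebra `R`. -/
def HasZero (A : Matrix ι ι K) (R : Type*) [CommRing R] [Algebra K R] : Prop :=
  ∃ v : ι → R, v ≠ 0 ∧ matrixValue A v = 0

/-- The group generated by products of two nonzero values of the form with matrix `A`. -/
def matrixValueSqGroup (A : Matrix ι ι K) : Subgroup Kˣ :=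
  Subgroup.closure {c | ∃ v w : ι → K, (c : K) = matrixValue A v * matrixValue A w}

variable {A : Matrix ι ι K} {R S : Type*} [CommRing R] [Algebra K R] [CommRing S] [Algebra K S]

theorem matrixValue_map (f : R →ₐ[K] S) (v : ι → R) :
    matrixValue A (fun i => f (v i)) = f (matrixValue A v) := by
  simp [matrixValue]

theorem matrixValue_mul (c : R) (v : ι → R) :
    matrixValue A (fun i => c * v i) = c ^ 2 * matrixValue A v := by
  simp only [matrixValue, Finset.mul_sum]
  exact Finset.sum_congr rfl fun i _ => Finset.sum_congr rfl fun j _ => by ring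

theorem matrixValue_mul_add (c : R) (v w : ι → R) :
    matrixValue A (fun i => c * v i + w i) = c ^ 2 * matrixValue A v +
      c * (matrixValue A (fun i => v i + w i) - matrixValue A v - matrixValue A w) +
        matrixValue A w := by
  simp only [matrixValue, Finset.mul_sum, ← Finset.sum_sub_distrib, ← Finset.sum_add_distrib]
  exact Finset.sum_congr rfl fun i _ => Finset.sum_congr rfl fun j _ => by ring

theorem matrixValue_baseChange {L : Type*} [Field L] [Algebra K L] [Algebra L R]
    [IsScalarTower K L R] (v : ι → R) :
    matrixValue (A.map (algebraMap K L)) v = matrixValue A v := by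
  simp [matrixValue, ← IsScalarTower.algebraMap_apply]

theorem HasZero.map (h : HasZero A R) (f : R →ₐ[K] S) (hf : Function.Injective f) :
    HasZero A S := by
  obtain ⟨v, hv, h⟩ := h
  refine ⟨fun i => f (v i), fun h0 => hv ?_, by rw [matrixValue_map, h, map_zero]⟩
  funext i
  exact hf (by simpa using congrFun h0 i)

theorem matrixValue_ne_zero (hA : ¬ HasZero A K) {v : ι → K} (hv : v ≠ 0) :
    matrixValue A v ≠ 0 := fun h => hA ⟨v, hv, h⟩

/-- Divide `q(tv) q(v) = t² q(v)²` by `q(v)²`. Membership in the group thus depends only on the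
square class. -/
theorem sq_mem_matrixValueSqGroup [Nonempty ι] (hA : ¬ HasZero A K) (t : Kˣ) :
    t ^ 2 ∈ matrixValueSqGroup A := by
  classical
  obtain ⟨i⟩ := ‹Nonempty ι›
  set v : ι → K := Pi.single i 1
  have hv : matrixValue A v ≠ 0 := matrixValue_ne_zero hA fun h => by
    simpa [v] using congrFun h i
  have h1 : Units.mk0 _ hv * Units.mk0 _ hv ∈ matrixValueSqGroup A :=
    Subgroup.subset_closure ⟨v, v, by simp⟩
  have h2 : t ^ 2 * (Units.mk0 _ hv * Units.mk0 _ hv) ∈ matrixValueSqGroup A :=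
    Subgroup.subset_closure ⟨fun i => (t : K) * v i, v, by
      rw [matrixValue_mul]; simp [mul_assoc]⟩
  rw [← mul_inv_cancel_right (t ^ 2) (Units.mk0 _ hv * Units.mk0 _ hv)]
  exact mul_mem h2 (inv_mem h1)

/-- The values of `f / leadingCoeff f` are in the value group, and the degree is even. -/
def ValuesInGroup (A : Matrix ι ι K) (f : K[X]) : Prop :=
  Even f.natDegree ∧
    ∀ (c : K) (u : Kˣ), f.eval c = f.leadingCoeff * u → u ∈ matrixValueSqGroup A

/-- Degrees add, and values normalized by the leading coefficient multiply; the normalization makes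
constants harmless. -/
theorem ValuesInGroup.of_irreducible_factors {g : K[X]} (hg : g ≠ 0)
    (h : ∀ p, Irreducible p → p ∣ g → ValuesInGroup A p) : ValuesInGroup A g := by
  induction g using WfDvdMonoid.induction_on_irreducible with
  | zero => exact absurd rfl hg
  | unit u hu =>
    obtain ⟨c, hc, rfl⟩ := Polynomial.isUnit_iff.1 hu
    refine ⟨by simp, fun x u hx => ?_⟩
    have : u = 1 := by
      have h0 := hc.ne_zero
      simp only [eval_C, leadingCoeff_C] at hx
      ext
      rw [Units.val_one]
      exact mul_left_cancel₀ h0 (by rw [← hx, mul_one])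
    rw [this]
    exact one_mem _
  | mul a p ha hp ih =>
    have h1 := h p hp (dvd_mul_right _ _)
    have h2 := ih ha fun r hr hra => h r hr (hra.mul_left _)
    refine ⟨by rw [natDegree_mul hp.ne_zero ha]; exact h1.1.add h2.1, fun c u hu => ?_⟩
    have hlp := leadingCoeff_ne_zero.2 hp.ne_zero
    have hla := leadingCoeff_ne_zero.2 ha
    rw [eval_mul, leadingCoeff_mul] at hu
    have hne : p.eval c * a.eval c ≠ 0 := by
      rw [hu]; exact mul_ne_zero (mul_ne_zero hlp hla) u.ne_zero
    have e1 := h1.2 c (Units.mk0 (p.eval c / p.leadingCoeff)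
      (div_ne_zero (left_ne_zero_of_mul hne) hlp)) (by simp; field_simp)
    have e2 := h2.2 c (Units.mk0 (a.eval c / a.leadingCoeff)
      (div_ne_zero (right_ne_zero_of_mul hne) hla)) (by simp; field_simp)
    convert mul_mem e1 e2
    ext
    simp only [Units.val_mul, Units.val_mk0]
    field_simp
    rw [hu]; ring

/-- Lift the zero to remainders modulo `f` and divide by the gcd `d` of the coordinates. By degree
`f` does not divide a nonzero remainder, so `f` is prime to `d` and still divides the value after
division by `d²`. Primitivity keeps the vector nonzero modulo every irreducible polynomial. -/
theorem exists_primitive_lift {f : K[X]} (hf : Irreducible f) (h : HasZero A (AdjoinRoot f)) :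
    ∃ w : ι → K[X], (∀ i, (w i).natDegree < f.natDegree) ∧ f ∣ matrixValue A w ∧
      ∀ p, Irreducible p → ∃ i, ¬ p ∣ w i := by
  classical
  obtain ⟨v, hv, hv0⟩ := h
  choose z hz using fun i => AdjoinRoot.mk_surjective (g := f) (v i)
  set w : ι → K[X] := fun i => z i % f with hw
  have hmk : ∀ i, AdjoinRoot.mk f (w i) = v i := fun i => by
    rw [← hz i, AdjoinRoot.mk_eq_mk]
    refine ⟨-(z i / f), ?_⟩
    have := EuclideanDomain.div_add_mod (z i) f
    simp only [hw]
    linear_combination this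
  obtain ⟨i₀, hi₀⟩ := Function.ne_iff.1 hv
  have hw0 : w i₀ ≠ 0 := fun h0 => hi₀ (by rw [← hmk, h0, map_zero]; rfl)
  have hdeg : ∀ i, w i ≠ 0 → (w i).natDegree < f.natDegree := fun i hi =>
    natDegree_lt_natDegree hi (EuclideanDomain.mod_lt (z i) hf.ne_zero)
  have hdvd : f ∣ matrixValue A w := by
    rw [← AdjoinRoot.mk_eq_zero, ← hv0]
    rw [← funext hmk]
    exact (matrixValue_map (AdjoinRoot.mkₐ f) w).symm
  let := UniqueFactorizationMonoid.toNormalizedGCDMonoid K[X]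
  obtain ⟨w', hw', hg1⟩ := Finset.extract_gcd (s := Finset.univ) w ⟨i₀, Finset.mem_univ _⟩
  set d := Finset.univ.gcd w with hd
  have hd0 : d ≠ 0 := fun h0 => hw0 (Finset.gcd_eq_zero_iff.1 h0 i₀ (Finset.mem_univ _))
  have hdf : IsCoprime f d := by
    rw [hf.coprime_iff_not_dvd]
    intro hfd
    have h1 : f ∣ w i₀ := hfd.trans (Finset.gcd_dvd (Finset.mem_univ _))
    exact (natDegree_le_of_dvd h1 hw0).not_gt (hdeg _ hw0)
  have hval : matrixValue A w = d ^ 2 * matrixValue A w' := by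
    rw [← matrixValue_mul]
    congr 1
    exact funext fun i => hw' i (Finset.mem_univ _)
  refine ⟨w', fun i => ?_, ?_, fun p hp => ?_⟩
  · by_cases h0 : w' i = 0
    · rw [h0, natDegree_zero]
      exact hf.natDegree_pos
    · have h1 : w i ≠ 0 := by rw [hw' i (Finset.mem_univ _)]; exact mul_ne_zero hd0 h0
      refine lt_of_le_of_lt ?_ (hdeg i h1)
      exact natDegree_le_of_dvd ⟨d, by rw [hw' i (Finset.mem_univ _), mul_comm]⟩ h1
  · rw [hval] at hdvd
    exact (hdf.pow_right).dvd_of_dvd_mul_left hdvd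
  · by_contra! hcon
    exact hp.not_isUnit (isUnit_of_dvd_one (hg1 ▸ Finset.dvd_gcd fun i _ => hcon i))

/-- With `D` the largest degree of a coordinate, the coefficient of `X ^ (2 * D)` in the value is
the form at the vector `l` of coefficients of `X ^ D`. Anisotropy prevents it from vanishing. -/
theorem matrixValue_natDegree_leadingCoeff (hA : ¬ HasZero A K) {w : ι → K[X]} (hw : w ≠ 0) :
    ∃ (D : ℕ) (l : ι → K), l ≠ 0 ∧ (∃ i, D = (w i).natDegree) ∧
      (matrixValue A w).natDegree = 2 * D ∧ (matrixValue A w).leadingCoeff = matrixValue A l := by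
  obtain ⟨i₁, hi₁⟩ := Function.ne_iff.1 hw
  obtain ⟨i₀, -, hi₀⟩ := Finset.exists_max_image Finset.univ (fun i => (w i).degree)
    ⟨i₁, Finset.mem_univ _⟩
  have hne : w i₀ ≠ 0 := fun h => hi₁ (by
    simpa [h] using hi₀ i₁ (Finset.mem_univ _))
  set D := (w i₀).natDegree with hD
  have hle : ∀ i, (w i).natDegree ≤ D := fun i => natDegree_le_natDegree (hi₀ i (Finset.mem_univ _))
  set l : ι → K := fun i => (w i).coeff D with hl
  have hl0 : l ≠ 0 := fun h => hne (leadingCoeff_eq_zero.1 (congrFun h i₀))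
  have hcoeff : (matrixValue A w).coeff (2 * D) = matrixValue A l := by
    simp only [matrixValue, finsetSum_coeff]
    refine Finset.sum_congr rfl fun i _ => Finset.sum_congr rfl fun j _ => ?_
    rw [mul_assoc, algebraMap_eq, coeff_C_mul, two_mul,
      coeff_mul_add_eq_of_natDegree_le (hle i) (hle j)]
    simp [hl, mul_assoc]
  have hdeg : (matrixValue A w).natDegree ≤ 2 * D := by
    refine natDegree_sum_le_of_forall_le _ _ fun i _ => natDegree_sum_le_of_forall_le _ _ fun j _ => ?_
    rw [mul_assoc, algebraMap_eq, two_mul]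
    exact (natDegree_C_mul_le _ _).trans (natDegree_mul_le_of_le (hle i) (hle j))
  have h0 := matrixValue_ne_zero hA hl0
  have heq : (matrixValue A w).natDegree = 2 * D :=
    natDegree_eq_of_le_of_coeff_ne_zero hdeg (by rwa [hcoeff])
  exact ⟨D, l, hl0, ⟨i₀, rfl⟩, heq, by rw [leadingCoeff, heq, hcoeff]⟩

/-- Springer's theorem and Knebusch's norm principle for one irreducible polynomial. -/
theorem ValuesInGroup.of_hasZero (hA : ¬ HasZero A K) {f : K[X]} (hf : Irreducible f)
    (h : HasZero A (AdjoinRoot f)) : ValuesInGroup A f := by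
  induction hN : f.natDegree using Nat.strong_induction_on generalizing f with
  | h N ih =>
  obtain ⟨w, hdeg, ⟨g, hg⟩, hprim⟩ := exists_primitive_lift hf h
  have hw : w ≠ 0 := by
    rintro rfl
    obtain ⟨i, hi⟩ := hprim f hf
    exact hi (dvd_zero _)
  obtain ⟨D, l, hl, ⟨i, hi⟩, hD, hlead⟩ := matrixValue_natDegree_leadingCoeff hA hw
  have hl0 := matrixValue_ne_zero hA hl
  have hmv : matrixValue A w ≠ 0 := fun h0 => hl0 (by rw [← hlead, h0, leadingCoeff_zero])
  have hg0 : g ≠ 0 := by rintro rfl; exact hmv (by rw [hg, mul_zero])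
  have hdsum : f.natDegree + g.natDegree = 2 * D := by
    rw [← natDegree_mul hf.ne_zero hg0, ← hg, hD]
  have hDlt := hdeg i
  -- Here `deg g = 2D - deg f < deg f`. Modulo an irreducible factor `p` of `g`, the primitive
  -- vector `w` is a nontrivial zero, so the induction applies to `p`.
  have hgood : ValuesInGroup A g := by
    refine .of_irreducible_factors hg0 fun p hp hpg => ?_
    have hple := natDegree_le_of_dvd hpg hg0
    refine ih p.natDegree (by omega) hp ?_ rfl
    obtain ⟨j, hj⟩ := hprim p hp
    refine ⟨fun i => AdjoinRoot.mkₐ p (w i), fun h0 => hj ?_, ?_⟩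
    · exact AdjoinRoot.mk_eq_zero.1 (congrFun h0 j)
    · rw [matrixValue_map]
      exact AdjoinRoot.mk_eq_zero.2 (hg ▸ hpg.mul_left f)
  refine ⟨?_, fun c u hu => ?_⟩
  · obtain ⟨e, he⟩ := hgood.1
    exact ⟨D - e, by omega⟩
  -- Primitivity at `X - c` gives `w(c) ≠ 0`, so `f(c) g(c) = q(w(c))` is a nonzero value of the
  -- form.
  · have hwc : (fun i => (w i).eval c) ≠ 0 := by
      intro h0
      obtain ⟨j, hj⟩ := hprim (X - C c) (irreducible_X_sub_C c)
      exact hj (dvd_iff_isRoot.2 (congrFun h0 j))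
    have hvc := matrixValue_ne_zero hA hwc
    have heval : f.eval c * g.eval c = matrixValue A fun i => (w i).eval c := by
      have := matrixValue_map (A := A) (aeval (R := K) c) w
      simp only [coe_aeval_eq_eval] at this
      rw [this, hg, eval_mul]
    have hlg := leadingCoeff_ne_zero.2 hg0
    have hlf := leadingCoeff_ne_zero.2 hf.ne_zero
    have hgc : g.eval c ≠ 0 := fun h0 => hvc (by rw [← heval, h0, mul_zero])
    have e2 := hgood.2 c (Units.mk0 (g.eval c / g.leadingCoeff) (div_ne_zero hgc hlg))
      (by simp; field_simp)
    have e3 : Units.mk0 _ hvc * Units.mk0 _ hl0 ∈ matrixValueSqGroup A :=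
      Subgroup.subset_closure ⟨_, _, rfl⟩
    have e4 : Units.mk0 _ hl0 * Units.mk0 _ hl0 ∈ matrixValueSqGroup A :=
      Subgroup.subset_closure ⟨_, _, rfl⟩
    have e5 : f.leadingCoeff * g.leadingCoeff = matrixValue A l := by
      rw [← leadingCoeff_mul, ← hg, hlead]
    -- With `lc` the leading coefficient, `f(c)/lc f = q(w(c)) q(l) · q(l)⁻² · (g(c)/lc g)⁻¹`.
    convert mul_mem (mul_mem e3 (inv_mem e4)) (inv_mem e2) using 1
    rw [eq_mul_inv_iff_mul_eq, eq_mul_inv_iff_mul_eq]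
    ext
    simp only [Units.val_mul, Units.val_mk0]
    rw [← e5, ← heval, hu]
    field_simp

variable {E : Type*} [Field E] [Algebra K E] [FiniteDimensional K E]

theorem ValuesInGroup.of_adjoin_simple (hA : ¬ HasZero A K) (θ : E)
    (h : HasZero A (IntermediateField.adjoin K {θ})) : ValuesInGroup A (minpoly K θ) := by
  have hint : IsIntegral K θ := .of_finite K θ
  refine .of_hasZero hA (minpoly.irreducible hint) (h.map
    (IntermediateField.adjoinRootEquivAdjoin K hint).symm.toAlgHom ?_)
  exact (IntermediateField.adjoinRootEquivAdjoin K hint).symm.injective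

/-- Springer's theorem: a form that becomes isotropic over a separable extension of odd degree is
isotropic. -/
theorem even_finrank_of_hasZero [Algebra.IsSeparable K E] (hA : ¬ HasZero A K)
    (h : HasZero A E) : Even (Module.finrank K E) := by
  obtain ⟨θ, hθ⟩ := Field.exists_primitive_element K E
  have h1 : HasZero A (IntermediateField.adjoin K {θ}) := by
    rw [hθ]
    exact h.map (IntermediateField.topEquiv (F := K) (E := E)).symm.toAlgHom
      (IntermediateField.topEquiv (F := K) (E := E)).symm.injective
  have h2 := (ValuesInGroup.of_adjoin_simple hA θ h1).1
  rwa [← IntermediateField.adjoin.finrank (.of_finite K θ), hθ,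
    IntermediateField.finrank_top'] at h2

/-- Knebusch's norm principle, for an extension over which the form is isotropic. -/
theorem norm_mem_matrixValueSqGroup [Algebra.IsSeparable K E] (hA : ¬ HasZero A K)
    (h : HasZero A E) (α : E) (u : Kˣ) (hu : (u : K) = Algebra.norm K α) :
    u ∈ matrixValueSqGroup A := by
  have : Nonempty ι := by
    obtain ⟨v, hv, -⟩ := h
    obtain ⟨i, -⟩ := Function.ne_iff.1 hv
    exact ⟨i⟩
  have hint : IsIntegral K α := .of_finite K α
  set L := IntermediateField.adjoin K {α} with hL
  have hα := Algebra.norm_eq_norm_adjoin K α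
  have hN0 : Algebra.norm K (IntermediateField.AdjoinSimple.gen K α) ≠ 0 := by
    intro h0
    rw [h0, zero_pow Module.finrank_pos.ne'] at hα
    exact u.ne_zero (hu.trans hα)
  have hu' : u = Units.mk0 _ hN0 ^ Module.finrank L E := by
    ext
    simp only [hu, hα, Units.val_pow_eq_pow_val, Units.val_mk0]
    rfl
  -- If the form is isotropic over `L = K(α)`, the degree of the minimal polynomial is even and its
  -- value at 0 is the norm from `L`. Otherwise Springer over `L` makes `[E : L]` even, and the norm
  -- from `E` is a square.
  by_cases hz : HasZero A L
  · have h1 := ValuesInGroup.of_adjoin_simple hA α hz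
    rw [hu']
    refine pow_mem (h1.2 0 _ ?_) _
    have h2 := Algebra.PowerBasis.norm_gen_eq_coeff_zero_minpoly
      (IntermediateField.adjoin.powerBasis hint)
    rw [IntermediateField.adjoin.powerBasis_gen, IntermediateField.adjoin.powerBasis_dim,
      h1.1.neg_one_pow, one_mul, IntermediateField.minpoly_gen] at h2
    rw [Units.val_mk0, h2, (minpoly.monic hint).leadingCoeff, one_mul, coeff_zero_eq_eval_zero]
  · have h1 : Even (Module.finrank L E) := by
      refine even_finrank_of_hasZero (A := A.map (algebraMap K L)) ?_ ?_
      · rintro ⟨v, hv, hv0⟩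
        exact hz ⟨v, hv, by rw [← hv0, matrixValue_baseChange]⟩
      · obtain ⟨v, hv, hv0⟩ := h
        exact ⟨v, hv, by rw [← hv0, matrixValue_baseChange]⟩
    obtain ⟨e, he⟩ := h1
    rw [hu', he, ← two_mul, mul_comm, pow_mul]
    exact sq_mem_matrixValueSqGroup hA _

end Values

end GWTransfer

namespace GWTransfer

noncomputable section

/-! ### Diagonal forms and their relations in the Grothendieck–Witt ring. -/

section Diagonal

variable {F : Type u} [Field F] [Invertible (2 : F)]

/-- A form-preserving map out of a regular space is injective, its kernel being in the radical;
equality of dimensions does the rest. -/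
theorem equivalent_of_linearMap {V W : Type*} [AddCommGroup V] [Module F V]
    [FiniteDimensional F V] [AddCommGroup W] [Module F W] [FiniteDimensional F W]
    {Q : QuadraticForm F V} {Q' : QuadraticForm F W} (hQ : Q.Nondegenerate) (f : V →ₗ[F] W)
    (hf : ∀ v, Q' (f v) = Q v) (hr : Module.finrank F V = Module.finrank F W) :
    Q.Equivalent Q' := by
  have hcomp : Q'.comp f = Q := QuadraticMap.ext hf
  have hinj : Function.Injective f := by
    rw [injective_iff_map_eq_zero]
    intro x hx
    refine (nondegenerate_iff Q).1 hQ x fun y => ?_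
    rw [← hcomp, QuadraticMap.associated_comp]
    simp [hx]
  exact ⟨{ LinearEquiv.ofInjectiveOfFinrankEq f hinj hr with map_app' := hf }⟩

theorem nondegenerate_smul_sq (a : Fˣ) :
    ((a : F) • QuadraticMap.sq : QuadraticForm F F).Nondegenerate := by
  rw [nondegenerate_iff]
  intro x hx
  simpa using hx 1

/-- The form `⟨a⟩`. -/
def QuadSpace.unary (a : Fˣ) : QuadSpace F where
  carrier := F
  form := (a : F) • QuadraticMap.sq
  regular := nondegenerate_smul_sq a

/-- The class of `⟨a⟩` in `GW F`. -/
def unary (a : Fˣ) : GW F := GW.of (.mk (.unary a))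

theorem unary_mul_sq (a t : Fˣ) : unary (a * t ^ 2) = unary a := by
  have h : (((a * t ^ 2 : Fˣ) : F) • QuadraticMap.sq : QuadraticForm F F).Equivalent
      ((a : F) • QuadraticMap.sq) := by
    refine equivalent_of_linearMap (nondegenerate_smul_sq _) (LinearMap.mulLeft F (t : F))
      (fun v => ?_) rfl
    simp
    ring
  exact congrArg GW.of (IsoClass.mk_eq (S := .unary (a * t ^ 2)) (T := .unary a) h)

theorem unary_one : unary (1 : Fˣ) = 1 := by
  have h : (((1 : Fˣ) : F) • QuadraticMap.sq : QuadraticForm F F).Equivalent QuadraticMap.sq := by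
    rw [Units.val_one, one_smul]
  exact congrArg GW.of (IsoClass.mk_eq (S := .unary 1) (T := .one F) h)

theorem unary_mul_unary (a b : Fˣ) : unary a * unary b = unary (a * b) := by
  have h : (((a * b : Fˣ) : F) • QuadraticMap.sq : QuadraticForm F F).Equivalent
      (QuadraticForm.tmul ((a : F) • QuadraticMap.sq : QuadraticForm F F)
        ((b : F) • QuadraticMap.sq : QuadraticForm F F)) := by
    refine equivalent_of_linearMap (nondegenerate_smul_sq _)
      (LinearMap.toSpanSingleton F (F ⊗[F] F) (1 ⊗ₜ 1)) (fun v => ?_) (by simp)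
    rw [LinearMap.toSpanSingleton_apply, TensorProduct.smul_tmul', QuadraticForm.tmul,
      QuadraticForm.tensorDistrib_tmul]
    simp
    ring
  rw [unary, unary, GW.of_mul_of]
  exact congrArg GW.of (IsoClass.mk_eq (S := (QuadSpace.unary a).mul (.unary b))
    (T := .unary (a * b)) h.symm)

/-- The condition on `Q (u + w)` says that `u` and `w` are orthogonal. -/
theorem equivalent_prod_smul_sq {V : Type*} [AddCommGroup V] [Module F V] [FiniteDimensional F V]
    (Q : QuadraticForm F V) (hV : Module.finrank F V = 2) (u w : V) (a b : Fˣ)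
    (hu : Q u = a) (hw : Q w = b) (huw : Q (u + w) = a + b) :
    (((a : F) • QuadraticMap.sq : QuadraticForm F F).prod
      ((b : F) • QuadraticMap.sq : QuadraticForm F F)).Equivalent Q := by
  refine equivalent_of_linearMap (nondegenerate_prod (nondegenerate_smul_sq a)
    (nondegenerate_smul_sq b)) ((LinearMap.toSpanSingleton F V u).coprod
        (LinearMap.toSpanSingleton F V w)) ?_ (by simp [hV])
  rintro ⟨x, y⟩
  have h1 : QuadraticMap.polar Q u w = 0 := by
    rw [QuadraticMap.polar, huw, hu, hw]
    ring
  rw [LinearMap.coprod_apply, LinearMap.toSpanSingleton_apply, LinearMap.toSpanSingleton_apply,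
    QuadraticMap.map_add Q, QuadraticMap.polar_smul_left, QuadraticMap.polar_smul_right,
    QuadraticMap.map_smul, QuadraticMap.map_smul, h1, hu, hw]
  simp
  ring

theorem unary_add_unary (a b : Fˣ) : unary a + unary b =
    GW.of (.mk ((QuadSpace.unary a).add (.unary b))) := by
  rw [unary, unary, ← map_add]
  rfl

theorem binary_eq (a b : Fˣ) : binary a b = unary a + unary b := by
  have h := equivalent_prod_smul_sq (QuadraticMap.weightedSumSquares F ![(a : F), (b : F)])
    (by simp) ![1, 0] ![0, 1] a b (by simp [QuadraticMap.weightedSumSquares_apply])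
    (by simp [QuadraticMap.weightedSumSquares_apply])
    (by simp [QuadraticMap.weightedSumSquares_apply, -Matrix.cons_add, Fin.sum_univ_two])
  rw [unary_add_unary]
  exact congrArg GW.of (IsoClass.mk_eq (S := .binary a b)
    (T := (QuadSpace.unary a).add (.unary b)) h.symm)

theorem unary_add_unary_neg (a : Fˣ) : unary a + unary (-a) = unary 1 + unary (-1) := by
  have h2 : (2 : F) ≠ 0 := Invertible.ne_zero 2
  -- The form is `a(x + y)(x - y)`. The first vector has `x + y = 1` and `x - y = a⁻¹`; swapping
  -- coordinates changes the sign of the value; the sum of the two vectors has `x = y`, hence value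
  -- 0.
  have h := equivalent_prod_smul_sq (QuadraticMap.weightedSumSquares F ![(a : F), -(a : F)])
    (by simp) ![2⁻¹ * (1 + (a : F)⁻¹), 2⁻¹ * (1 - (a : F)⁻¹)]
    ![2⁻¹ * (1 - (a : F)⁻¹), 2⁻¹ * (1 + (a : F)⁻¹)] 1 (-1)
    (by simp [QuadraticMap.weightedSumSquares_apply]; field_simp; ring)
    (by simp [QuadraticMap.weightedSumSquares_apply]; field_simp; ring)
    (by simp [QuadraticMap.weightedSumSquares_apply]; ring)
  rw [← binary_eq, unary_add_unary]
  exact congrArg GW.of (IsoClass.mk_eq (S := .binary a (-a))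
    (T := (QuadSpace.unary 1).add (.unary (-1))) h.symm)

/-- The diagonal form `⟨w₁, …, wₙ⟩`. -/
def QuadSpace.diagonal {n : ℕ} (w : Fin n → Fˣ) : QuadSpace F where
  carrier := Fin n → F
  form := QuadraticMap.weightedSumSquares F w
  regular := by
    have : NeZero (2 : F) := ⟨Invertible.ne_zero 2⟩
    have h : QuadraticMap.weightedSumSquares F w =
        QuadraticMap.weightedSumSquares F (fun i => (w i : F)) := by
      ext v
      simp [QuadraticMap.weightedSumSquares_apply, Units.smul_def]
    rw [h, QuadraticMap.nondegenerate_iff_radical_eq_bot,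
      QuadraticForm.radical_weightedSumSquares]
    ext v
    simp [Pi.mem_spanSubset_iff, funext_iff]

theorem of_mk_diagonal {n : ℕ} (w : Fin n → Fˣ) :
    GW.of (.mk (.diagonal w)) = ∑ i, unary (w i) := by
  induction n with
  | zero =>
    rw [Finset.univ_eq_empty, Finset.sum_empty, ← map_zero GW.of]
    have h0 : Subsingleton (QuadSpace.zero F).carrier := inferInstanceAs (Subsingleton PUnit)
    have h1 : Subsingleton (QuadSpace.diagonal w).carrier :=
      inferInstanceAs (Subsingleton (Fin 0 → F))
    exact congrArg GW.of (IsoClass.mk_eq (equivalent_of_subsingleton _ _))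
  | succ n ih =>
    rw [Fin.sum_univ_succ, ← ih fun i : Fin n => w i.succ, unary, ← map_add]
    have h : (QuadraticMap.weightedSumSquares F w).Equivalent
        (((w 0 : F) • QuadraticMap.sq : QuadraticForm F F).prod
          (QuadraticMap.weightedSumSquares F fun i : Fin n => w i.succ)) := by
      refine equivalent_of_linearMap (QuadSpace.diagonal w).regular
        ((LinearMap.proj (R := F) (φ := fun _ : Fin (n + 1) => F) 0).prod
          (LinearMap.funLeft F F Fin.succ)) (fun v => ?_) (by simp [add_comm])
      simp [QuadraticMap.weightedSumSquares_apply, Fin.sum_univ_succ, Units.smul_def,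
        LinearMap.funLeft_apply]
    exact congrArg GW.of (IsoClass.mk_eq (S := .diagonal w)
      (T := (QuadSpace.unary (w 0)).add (.diagonal fun i : Fin n => w i.succ)) h)

/-- Diagonalization: additive statements about transfers need only be checked on unary forms. -/
theorem closure_range_unary : AddSubgroup.closure (Set.range (unary (F := F))) = ⊤ := by
  have key : ∀ a : IsoClass F, GW.of a ∈ AddSubgroup.closure (Set.range (unary (F := F))) := by
    intro a
    induction a using Quotient.inductionOn with
    | h S =>
      obtain ⟨w, hw⟩ := QuadraticForm.equivalent_weightedSumSquares_units_of_nondegenerate' S.form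
        (QuadraticMap.nondegenerate_associated_iff.2 S.regular).1
      have : IsoClass.mk S = .mk (.diagonal w) := IsoClass.mk_eq hw
      change GW.of (IsoClass.mk S) ∈ _
      rw [this, of_mk_diagonal]
      exact sum_mem fun i _ => AddSubgroup.subset_closure ⟨_, rfl⟩
  rw [eq_top_iff]
  intro x _
  obtain ⟨a, b, rfl⟩ := GW.exists_of_sub_of x
  exact sub_mem (key a) (key b)

end Diagonal

/-! ### The signed discriminant on virtual forms of even rank. -/

section Disc

variable {F : Type u} [Field F] [Invertible (2 : F)]

omit [Invertible (2 : F)] in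
theorem squareClass_sq (a : Fˣ) : squareClass F (a ^ 2) = 1 :=
  (QuotientGroup.eq_one_iff _).2 ⟨a, rfl⟩

theorem rank_of_mk (S : QuadSpace F) : rank (GW.of (.mk S)) = Module.finrank F S.carrier :=
  GW.lift_of _ _

theorem det_of_mk (S : QuadSpace F) {ι : Type*} [Fintype ι] [DecidableEq ι]
    (b : Module.Basis ι F S.carrier) :
    (det (GW.of (.mk S))).toMul = squareClass F (S.detUnit b) :=
  (congrArg Additive.toMul (GW.lift_of IsoClass.det (.mk S))).trans
    (S.squareClass_detUnit S (.refl _) _ b)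

/-- For ranks `2a` and `2b` the sign exponents add up to an error `4ab`, which is even. In odd rank
additivity can fail. -/
theorem signedDisc_add {φ ψ : GW F} (hφ : Even (rank φ)) (hψ : Even (rank ψ)) :
    signedDisc (φ + ψ) = signedDisc φ * signedDisc ψ := by
  obtain ⟨a, ha⟩ := hφ
  obtain ⟨b, hb⟩ := hψ
  have h2 : squareClass F (-1) ^ (2 : ℤ) = 1 := by
    rw [zpow_ofNat, ← map_pow]
    exact squareClass_sq _
  have e1 : (a + a + (b + b)) * (a + a + (b + b) - 1) / 2 =
      (a + a) * (a + a - 1) / 2 + (b + b) * (b + b - 1) / 2 + 2 * (2 * a * b) := by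
    have hx : ∀ c : ℤ, (c + c) * (c + c - 1) / 2 = c * (c + c - 1) := fun c => by
      rw [← two_mul, mul_assoc]; exact Int.mul_ediv_cancel_left _ two_ne_zero
    have : a + a + (b + b) = (a + b) + (a + b) := by ring
    rw [this, hx, hx, hx]
    ring
  simp only [signedDisc, map_add, ha, hb, e1, zpow_add, zpow_mul, h2, one_zpow, mul_one,
    toMul_add]
  exact mul_mul_mul_comm _ _ _ _

theorem signedDisc_neg {φ : GW F} (hφ : Even (rank φ)) : signedDisc (-φ) = (signedDisc φ)⁻¹ := by
  have h0 : signedDisc (0 : GW F) = 1 := by simp [signedDisc]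
  rw [eq_inv_iff_mul_eq_one, ← signedDisc_add (by simpa using hφ) hφ, neg_add_cancel, h0]

/-- The virtual forms of even rank whose signed discriminant is in a given subgroup. -/
def discSubgroup (H : Subgroup (SquareClass F)) : AddSubgroup (GW F) where
  carrier := {φ | Even (rank φ) ∧ signedDisc φ ∈ H}
  zero_mem' := by simp [signedDisc, one_mem]
  add_mem' := fun {a b} ha hb => ⟨by rw [map_add]; exact ha.1.add hb.1, by
    rw [signedDisc_add ha.1 hb.1]; exact mul_mem ha.2 hb.2⟩
  neg_mem' := fun {a} ha => ⟨by simpa using ha.1, by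
    rw [signedDisc_neg ha.1]; exact inv_mem ha.2⟩

theorem signedDisc_binary (a b : Fˣ) : signedDisc (binary a b) = squareClass F (-(a * b)) := by
  have hr : rank (binary a b) = 2 := by
    rw [binary, rank_of_mk]
    exact congrArg Nat.cast (Module.finrank_fin_fun F)
  rw [signedDisc, hr, binary, det_of_mk _ (Pi.basisFun F (Fin 2))]
  have : (QuadSpace.binary a b).detUnit (Pi.basisFun F (Fin 2)) = a * b := by
    ext
    simp only [QuadSpace.detUnit, Units.val_mk0, Units.val_mul]
    have e : gram (QuadraticMap.weightedSumSquares F ![(a : F), (b : F)]) (Pi.basisFun F (Fin 2))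
        = !![(a : F), 0; 0, (b : F)] := by
      ext i j
      fin_cases i <;> fin_cases j <;>
        simp [QuadraticMap.associated_apply, QuadraticMap.weightedSumSquares_apply,
          LinearMap.BilinForm.toMatrix_apply]
      all_goals ring_nf; field_simp; try ring
    exact (congrArg Matrix.det e).trans (by simp [Matrix.det_fin_two])
  rw [this, ← neg_one_mul (a * b), map_mul _ (-1)]
  norm_num

end Disc

/-! ### Transfers of unary forms and their discriminants. -/

section TransferUnary

variable {k E : Type u} [Field k] [Field E] [Algebra k E] [FiniteDimensional k E]
  [Invertible (2 : k)] [Invertible (2 : E)]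

/-- The form `x ↦ s (α x²)` on `E`, over `k`. -/
def QuadSpace.transferUnary (s : E →ₗ[k] k) (hs : s ≠ 0) (α : Eˣ) : QuadSpace k where
  carrier := E
  form := s.compQuadraticMap' ((α : E) • QuadraticMap.sq)
  regular := nondegenerate_comp hs (nondegenerate_smul_sq α)

theorem transfer_unary (s : E →ₗ[k] k) (hs : s ≠ 0) (α : Eˣ) :
    transfer s hs (unary α) = GW.of (.mk (.transferUnary s hs α)) := by
  refine (GW.lift_of _ _).trans (congrArg GW.of (IsoClass.mk_eq
    (S := (QuadSpace.unary α).transfer k s hs) (T := .transferUnary s hs α)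
    ⟨{ toFun := fun v => v
       invFun := fun v => v
       left_inv := fun _ => rfl
       right_inv := fun _ => rfl
       map_add' := fun _ _ => rfl
       map_smul' := fun c v => (Algebra.smul_def c (show E from v)).symm
       map_app' := fun m => rfl }⟩))

-- The trace form of a separable extension is nondegenerate, so it identifies `E` with its dual.
omit [Invertible (2 : k)] [Invertible (2 : E)] in
theorem exists_trace_mul_eq [Algebra.IsSeparable k E] (s : E →ₗ[k] k) (hs : s ≠ 0) :
    ∃ β : E, β ≠ 0 ∧ ∀ x, s x = Algebra.trace k E (β * x) := by
  obtain ⟨β, hβ⟩ := (LinearMap.BilinForm.toDual (Algebra.traceForm k E)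
    (traceForm_nondegenerate k E)).surjective s
  have h : ∀ x, s x = Algebra.trace k E (β * x) := fun x => by
    rw [← hβ, LinearMap.BilinForm.toDual_def, Algebra.traceForm_apply]
  refine ⟨β, ?_, h⟩
  rintro rfl
  exact hs (LinearMap.ext fun x => by simp [h])

-- The form is the trace form twisted by multiplication by `β * α`, an endomorphism whose
-- determinant is the norm.
omit [FiniteDimensional k E] in
theorem det_gram_transferUnary {ι : Type*} [Fintype ι] [DecidableEq ι] (b : Module.Basis ι k E)
    (s : E →ₗ[k] k) (β : E) (hβ : ∀ x, s x = Algebra.trace k E (β * x)) (α : Eˣ) :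
    (gram (s.compQuadraticMap' ((α : E) • QuadraticMap.sq : QuadraticForm E E)) b).det =
      Algebra.norm k (β * α) * Algebra.discr k b := by
  have hgram : gram (s.compQuadraticMap' ((α : E) • QuadraticMap.sq : QuadraticForm E E)) b =
      LinearMap.BilinForm.toMatrix b
        ((Algebra.traceForm k E).compLeft (LinearMap.mulLeft k (β * (α : E)))) := by
    ext i j
    rw [gram, LinearMap.BilinForm.toMatrix_apply, LinearMap.BilinForm.toMatrix_apply,
      associated_comp, hβ]
    simp [Algebra.traceForm_apply, mul_assoc]
  rw [hgram, LinearMap.BilinForm.toMatrix_compLeft, Matrix.det_mul, Matrix.det_transpose,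
    LinearMap.det_toMatrix, Algebra.discr_def, Algebra.traceMatrix_of_basis, Algebra.norm_apply]
  rfl

/-- The signed discriminant of a transfer of a unary form is a norm. -/
theorem signedDisc_transfer_unary [Algebra.IsSeparable k E] (s : E →ₗ[k] k) (hs : s ≠ 0)
    (α : Eˣ) : ∃ (x : E) (u : kˣ), (u : k) = Algebra.norm k x ∧
      signedDisc (transfer s hs (unary α)) = squareClass k u := by
  obtain ⟨β, hβ, hsβ⟩ := exists_trace_mul_eq s hs
  let pb := Field.powerBasisOfFiniteOfSeparable k E
  have hdet := det_gram_transferUnary pb.basis s β hsβ α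
  -- The discriminant of a power basis is `(-1)^(m(m-1)/2)` times the norm of the derivative of the
  -- minimal polynomial at the generator, where `m = [E : k]`. This sign cancels the one in
  -- `signedDisc`.
  rw [Algebra.discr_powerBasis_eq_norm, mul_left_comm, ← map_mul] at hdet
  set x := β * α * Polynomial.aeval pb.gen (Polynomial.derivative (minpoly k pb.gen))
  have hN : Algebra.norm k x ≠ 0 := fun h0 => det_gram_ne_zero
    (QuadSpace.transferUnary s hs α).regular pb.basis (hdet.trans (by rw [h0, mul_zero]))
  refine ⟨x, Units.mk0 _ hN, rfl, ?_⟩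
  have hr : (Module.finrank k E : ℤ) * (Module.finrank k E - 1) / 2 =
      ((Module.finrank k E * (Module.finrank k E - 1) / 2 : ℕ) : ℤ) := by
    have := Module.finrank_pos (R := k) (M := E)
    push_cast [Nat.cast_sub this]
    rfl
  have hunit : (QuadSpace.transferUnary s hs α).detUnit pb.basis =
      (-1) ^ (Module.finrank k E * (Module.finrank k E - 1) / 2) * Units.mk0 _ hN := by
    ext
    exact hdet.trans (by simp)
  rw [transfer_unary, signedDisc, rank_of_mk, det_of_mk _ pb.basis, hunit]
  refine (congrArg (fun e => squareClass k (-1) ^ e * _) hr).trans ?_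
  rw [map_mul, map_pow, zpow_natCast, ← mul_assoc, ← mul_pow, ← map_mul, neg_mul_neg, one_mul,
    map_one, one_pow, one_mul]

/-- If `E` has even degree over `k`, transfers from `E` have even rank, and their signed
discriminants are in any subgroup that contains the classes of norms. -/
theorem transfer_mem_discSubgroup [Algebra.IsSeparable k E] (s : E →ₗ[k] k) (hs : s ≠ 0)
    (he : Even (Module.finrank k E)) (H : Subgroup kˣ)
    (hH : ∀ (x : E) (u : kˣ), (u : k) = Algebra.norm k x → u ∈ H) (ψ : GW E) :
    transfer s hs ψ ∈ discSubgroup (H.map (squareClass k)) := by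
  have h : (⊤ : AddSubgroup (GW E)) ≤
      (discSubgroup (H.map (squareClass k))).comap (transfer s hs) := by
    rw [← closure_range_unary, AddSubgroup.closure_le]
    rintro _ ⟨α, rfl⟩
    refine ⟨?_, ?_⟩
    · rw [transfer_unary, rank_of_mk]
      exact (Int.even_coe_nat _).2 he
    · obtain ⟨x, u, hu, h⟩ := signedDisc_transfer_unary s hs α
      rw [h]
      exact ⟨u, hH x u hu, rfl⟩
  exact h (AddSubgroup.mem_top ψ)

/-- A form `⟨a, b⟩` that is contained in `x ↦ s (α x²)`, for a quadratic extension. -/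
theorem unary_add_unary_mem_range_transfer (hE : Module.finrank k E = 2) (s : E →ₗ[k] k)
    (hs : s ≠ 0) (α : Eˣ) (u w : E) (a b : kˣ) (hu : s (α * (u * u)) = a)
    (hw : s (α * (w * w)) = b) (huw : s (α * (u * w)) = 0) :
    unary a + unary b ∈ (transfer s hs).range := by
  have h := equivalent_prod_smul_sq
    (s.compQuadraticMap' ((α : E) • QuadraticMap.sq : QuadraticForm E E)) hE u w a b
    (by simpa using hu) (by simpa using hw) (by
      have : (α : E) * ((u + w) * (u + w)) = α * (u * u) + α * (w * w) +
          (α * (u * w) + α * (u * w)) := by ring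
      simp [this, hu, hw, huw])
  refine ⟨unary α, ?_⟩
  rw [transfer_unary, unary_add_unary]
  exact congrArg GW.of (IsoClass.mk_eq (S := .transferUnary s hs α)
    (T := (QuadSpace.unary a).add (.unary b)) h.symm)

end TransferUnary

end

end GWTransfer

namespace GWTransfer

open AlgebraicGeometry CategoryTheory MvPolynomial

/-! ### Closed points of the quadric and zeros of the form. -/

section QuadricPoints

variable {k : Type u} [Field k] [Invertible (2 : k)] {n : ℕ} (q : QuadraticForm k (Fin n → k))

theorem matrixValue_toMatrix' {R : Type*} [CommRing R] [Algebra k R] (v : Fin n → R) :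
    matrixValue q.toMatrix' v = aeval v (quadricPoly q) := by
  simp [matrixValue, quadricPoly, algHom_C]

theorem matrixValue_toMatrix'_self (v : Fin n → k) : matrixValue q.toMatrix' v = q v := by
  have h : QuadraticMap.associated q v v =
      Matrix.toLinearMap₂' k q.toMatrix' v v := by
    rw [QuadraticForm.toMatrix', Matrix.toLinearMap₂'_toMatrix']
  rw [QuadraticMap.associated_eq_self_apply, Matrix.toLinearMap₂'_apply] at h
  rw [h, matrixValue]
  refine Finset.sum_congr rfl fun i _ => Finset.sum_congr rfl fun j _ => ?_
  simp only [Algebra.algebraMap_self, RingHom.id_apply, smul_eq_mul]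
  ring

/-- The coordinate functions in the homogeneous coordinate ring. -/
noncomputable def coord (i : Fin n) : CoordRing q := Ideal.Quotient.mk _ (X i)

theorem coord_mem (i : Fin n) : coord q i ∈ coordGrading q 1 :=
  mk_mem_coordGrading q (isHomogeneous_X k i)

theorem matrixValue_coord : matrixValue q.toMatrix' (coord q) = 0 := by
  have h := matrixValue_map (A := q.toMatrix') (Ideal.Quotient.mkₐ k (Ideal.span {quadricPoly q})) X
  rw [matrixValue_toMatrix' q X, aeval_X_left_apply] at h
  refine h.trans ?_
  exact Ideal.Quotient.eq_zero_iff_mem.2 (Ideal.mem_span_singleton_self _)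

theorem iSup_basicOpen_coord : ⨆ i, Proj.basicOpen (coordGrading q) (coord q i) = ⊤ := by
  refine Proj.iSup_basicOpen_eq_top' _ _ (fun i => ⟨1, coord_mem q i⟩) ?_
  rw [eq_top_iff]
  intro p _
  obtain ⟨p, rfl⟩ := Ideal.Quotient.mk_surjective p
  induction p using MvPolynomial.induction_on with
  | C a =>
    exact Subalgebra.algebraMap_mem (Algebra.adjoin (coordGrading q 0) (Set.range (coord q)))
      (algebraMap k (coordGrading q 0) a)
  | add p r hp hr => rw [map_add]; exact add_mem (hp trivial) (hr trivial)
  | mul_X p i hp =>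
    rw [map_mul]
    exact mul_mem (hp trivial) (Algebra.subset_adjoin ⟨i, rfl⟩)

omit [Invertible (2 : k)] in
theorem algebraMap_residueField (X : Scheme.{u}) [X.Over (Spec (.of k))] (x : X) :
    Spec.map (CommRingCat.ofHom (algebraMap k (ResidueField k X x))) =
      X.fromSpecResidueField x ≫ (X ↘ Spec (.of k)) :=
  Spec.map_preimage _

theorem quadric_over : (quadric q ↘ Spec (.of k)) = Proj.toSpecZero (coordGrading q) ≫
    Spec.map (CommRingCat.ofHom (algebraMap k (coordGrading q 0))) := rfl

/-- Replaces a point by a ring homomorphism out of an affine chart, where coordinates can be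
evaluated. -/
theorem exists_fromSpecResidueField_eq (x : Proj (coordGrading q)) :
    ∃ (i : Fin n) (φ : CommRingCat.of (HomogeneousLocalization.Away (coordGrading q) (coord q i)) ⟶
      (Proj (coordGrading q)).residueField x),
      (Proj (coordGrading q)).fromSpecResidueField x =
        Spec.map φ ≫ Proj.awayι (coordGrading q) (coord q i) (coord_mem q i) one_pos := by
  have hx : x ∈ (⊤ : (Proj (coordGrading q)).Opens) := trivial
  rw [← iSup_basicOpen_coord, TopologicalSpace.Opens.mem_iSup] at hx
  obtain ⟨i, hi⟩ := hx
  have hrange : Set.range ((Proj (coordGrading q)).fromSpecResidueField x) ⊆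
      Set.range (Proj.awayι (coordGrading q) (coord q i) (coord_mem q i) one_pos) := by
    rw [Scheme.range_fromSpecResidueField, Set.singleton_subset_iff]
    rwa [← Proj.opensRange_awayι (coordGrading q) (coord q i) (coord_mem q i) one_pos] at hi
  obtain ⟨φ, hφ⟩ := Spec.map_surjective (IsOpenImmersion.lift _ _ hrange)
  exact ⟨i, φ, by rw [hφ, IsOpenImmersion.lift_fac]⟩

/-- The affine coordinates on `D₊(xᵢ)`. -/
noncomputable def awayCoord (i j : Fin n) :
    HomogeneousLocalization.Away (coordGrading q) (coord q i) :=
  HomogeneousLocalization.Away.mk _ (coord_mem q i) 1 (coord q j) (coord_mem q j)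

noncomputable instance (i : Fin n) :
    Algebra k (HomogeneousLocalization.Away (coordGrading q) (coord q i)) :=
  ((HomogeneousLocalization.fromZeroRingHom (coordGrading q) _).comp
    (algebraMap k (coordGrading q 0))).toAlgebra

theorem awayCoord_self (i : Fin n) : awayCoord q i i = 1 := by
  apply HomogeneousLocalization.val_injective
  rw [awayCoord, HomogeneousLocalization.Away.val_mk, HomogeneousLocalization.val_one]
  simp

/-- Dehomogenization: in the localization, which contains the chart ring, `q(xⱼ / xᵢ) = xᵢ⁻² q(x) =
0`. -/
theorem matrixValue_awayCoord (i : Fin n) : matrixValue q.toMatrix' (awayCoord q i) = 0 := by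
  let f : HomogeneousLocalization.Away (coordGrading q) (coord q i) →ₐ[k]
      Localization.Away (coord q i) :=
    { algebraMap (HomogeneousLocalization.Away (coordGrading q) (coord q i))
        (Localization.Away (coord q i)) with
      commutes' := fun a => by
        change HomogeneousLocalization.val (HomogeneousLocalization.fromZeroRingHom
          (coordGrading q) _ (algebraMap k (coordGrading q 0) a)) = _
        rw [← HomogeneousLocalization.algebraMap_apply, ← HomogeneousLocalization.algebraMap_eq,
          ← IsScalarTower.algebraMap_apply (coordGrading q 0)
            (HomogeneousLocalization.Away (coordGrading q) (coord q i)),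
          IsScalarTower.algebraMap_apply (coordGrading q 0) (CoordRing q),
          IsScalarTower.algebraMap_apply k (CoordRing q) (Localization.Away (coord q i))]
        rfl }
  apply HomogeneousLocalization.val_injective
  change f _ = (HomogeneousLocalization.val
    (0 : HomogeneousLocalization.Away (coordGrading q) (coord q i)))
  rw [← matrixValue_map, HomogeneousLocalization.val_zero]
  have h : ∀ j, f (awayCoord q i j) = IsLocalization.Away.invSelf (coord q i) *
      IsScalarTower.toAlgHom k (CoordRing q) (Localization.Away (coord q i)) (coord q j) := by
    intro j
    change HomogeneousLocalization.val (awayCoord q i j) = _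
    rw [awayCoord, HomogeneousLocalization.Away.val_mk, Localization.mk_eq_mk',
      IsLocalization.mk'_eq_mul_mk'_one, mul_comm]
    simp only [pow_one]
    rfl
  rw [funext h, matrixValue_mul, matrixValue_map, matrixValue_coord, map_zero, mul_zero]

/-- The zero consists of the affine coordinates of `x` in a chart `D₊(xᵢ)`; its `i`-th entry is 1.
-/
theorem hasZero_residueField (x : quadric q) :
    HasZero q.toMatrix' (ResidueField k (quadric q) x) := by
  obtain ⟨i, φ, hφ⟩ := exists_fromSpecResidueField_eq q x
  -- Compatibility with the structure morphisms to `Spec k`, which makes `φ` a `k`-algebra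
  -- homomorphism.
  have h : Spec.map (CommRingCat.ofHom (algebraMap k (ResidueField k (quadric q) x))) =
      Spec.map (CommRingCat.ofHom (algebraMap k (HomogeneousLocalization.Away (coordGrading q)
        (coord q i))) ≫ φ) := by
    rw [algebraMap_residueField, quadric_over]
    refine (congrArg (· ≫ Proj.toSpecZero (coordGrading q) ≫
      Spec.map (CommRingCat.ofHom (algebraMap k (coordGrading q 0)))) hφ).trans ?_
    rw [Category.assoc, Proj.awayι_toSpecZero_assoc, ← Spec.map_comp, ← Spec.map_comp]
    rfl
  let φ' : HomogeneousLocalization.Away (coordGrading q) (coord q i) →ₐ[k]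
      ResidueField k (quadric q) x :=
    { (φ.hom : _ →+* _) with
      commutes' := fun a => (congr($(Spec.map_injective h).hom a)).symm }
  refine ⟨fun j => φ' (awayCoord q i j), fun h0 => ?_, by
    rw [matrixValue_map, matrixValue_awayCoord, map_zero]⟩
  have := congrFun h0 i
  rw [awayCoord_self, map_one] at this
  exact one_ne_zero this

/-- A zero `v` defines `xᵢ ↦ vᵢ` on the coordinate ring. Some `vᵢ` is a unit, so the irrelevant
ideal generates the unit ideal and an `E`-point of the quadric results. Its image `x` has residue
field inside `E`, hence finite over `k`, so `x` is closed. -/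
theorem exists_closed_point {E : Type u} [Field E] [Algebra k E] [FiniteDimensional k E]
    (h : HasZero q.toMatrix' E) :
    ∃ x : quadric q, IsClosed {x} ∧ Nonempty (ResidueField k (quadric q) x →ₐ[k] E) := by
  obtain ⟨v, hv, hv0⟩ := h
  let f₀ : CoordRing q →ₐ[k] E := Ideal.Quotient.liftₐ _ (aeval v) (by
    intro p hp
    obtain ⟨r, rfl⟩ := Ideal.mem_span_singleton.1 hp
    rw [map_mul, ← matrixValue_toMatrix', hv0, zero_mul])
  have hf₀ : ∀ i, f₀ (coord q i) = v i := fun i =>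
    (Ideal.Quotient.liftₐ_apply _ _ _ _).trans (aeval_X v i)
  let f : CoordRing q →+* Γ(Spec (.of E), ⊤) :=
    (Scheme.ΓSpecIso (.of E)).inv.hom.comp f₀.toRingHom
  have hf : (HomogeneousIdeal.irrelevant (coordGrading q)).toIdeal.map f = ⊤ := by
    obtain ⟨i, hi⟩ := Function.ne_iff.1 hv
    refine Ideal.eq_top_of_isUnit_mem _ (Ideal.mem_map_of_mem f (x := coord q i) ?_) ?_
    · refine (HomogeneousIdeal.mem_irrelevant_iff _ _).2 ?_
      rw [GradedRing.proj_apply, DirectSum.decompose_of_mem_ne _ (coord_mem q i) one_ne_zero]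
    · refine IsUnit.map (Scheme.ΓSpecIso (.of E)).inv.hom (x := f₀ (coord q i)) ?_
      rw [hf₀]
      exact (Ne.isUnit hi)
  let g : Spec (.of E) ⟶ quadric q := Proj.fromOfGlobalSections (coordGrading q) f hf
  have hg : g ≫ (quadric q ↘ Spec (.of k)) = Spec.map (CommRingCat.ofHom (algebraMap k E)) := by
    rw [quadric_over]
    refine (Proj.fromOfGlobalSections_toSpecZero_assoc (coordGrading q) f hf _).trans ?_
    rw [← Spec.map_comp]
    have : CommRingCat.ofHom (algebraMap k (coordGrading q 0)) ≫
        CommRingCat.ofHom (f.comp (algebraMap (coordGrading q 0) (CoordRing q))) =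
        CommRingCat.ofHom (algebraMap k E) ≫ (Scheme.ΓSpecIso (.of E)).inv := by
      ext a
      exact congrArg (Scheme.ΓSpecIso (.of E)).inv.hom (f₀.commutes a)
    rw [this, Spec.map_comp, toSpecΓ_SpecMap_ΓSpecIso_inv_assoc]
  obtain ⟨⟨x, ψ⟩, hψ⟩ := (Scheme.SpecToEquivOfField E (quadric q)).symm.surjective g
  replace hψ : Spec.map ψ ≫ (quadric q).fromSpecResidueField x = g := hψ
  have hcomp : Spec.map (CommRingCat.ofHom (algebraMap k (ResidueField k (quadric q) x)) ≫ ψ) =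
      Spec.map (CommRingCat.ofHom (algebraMap k E)) := by
    refine (Spec.map_comp _ _).trans ?_
    rw [algebraMap_residueField, ← hg, ← hψ]
    exact (Category.assoc _ _ _).symm
  let ψ' : ResidueField k (quadric q) x →ₐ[k] E :=
    { (ψ.hom : _ →+* _) with
      commutes' := fun a => congr($(Spec.map_injective hcomp).hom a) }
  have hfin : FiniteDimensional k (ResidueField k (quadric q) x) :=
    FiniteDimensional.of_injective ψ'.toLinearMap ψ'.toRingHom.injective
  refine ⟨x, ?_, ⟨ψ'⟩⟩
  have h1 : LocallyOfFiniteType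
      (Spec.map (CommRingCat.ofHom (algebraMap k (ResidueField k (quadric q) x)))) := by
    rw [HasRingHomProperty.Spec_iff (P := @LocallyOfFiniteType)]
    exact (RingHom.finite_algebraMap.2 hfin).finiteType
  rw [algebraMap_residueField] at h1
  have : JacobsonSpace (quadric q) := LocallyOfFiniteType.jacobsonSpace (quadric q ↘ Spec (.of k))
  exact isClosed_singleton_iff_locallyOfFiniteType.2
    (@locallyOfFiniteType_of_comp _ _ _ _ (quadric q ↘ Spec (.of k)) h1)

end QuadricPoints

end GWTransfer

namespace GWTransfer

/-! ### Transfers from quadratic extensions. -/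

section QuadraticExtension

variable {k K : Type u} [Field k] [Field K] [Algebra k K] [FiniteDimensional k K]
  [Invertible (2 : k)] [Invertible (2 : K)]

omit [FiniteDimensional k K] [Invertible (2 : k)] [Invertible (2 : K)] in
theorem algebraMap_ne_of_sq_eq {d : k} (hd : ¬ IsSquare d) {θ : K} (hθ : θ ^ 2 = algebraMap k K d)
    (r : k) : algebraMap k K r ≠ θ := by
  rintro rfl
  refine hd ⟨r, ?_⟩
  rw [← map_pow] at hθ
  rw [← (algebraMap k K).injective hθ, sq]

-- Take `γ ≠ 0` in the kernel of `s`. As `γ` and `γθ` form a basis of `K`, vanishing of `s` on `γθ`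
-- too would give `s = 0`. So `s(γ · _)` is a nonzero multiple of the `θ`-coordinate.
omit [Invertible (2 : k)] [Invertible (2 : K)] in
theorem exists_apply_eq_zero_apply_mul_ne_zero (hK : Module.finrank k K = 2) {d : k}
    (hd : ¬ IsSquare d) {θ : K} (hθ : θ ^ 2 = algebraMap k K d) (s : K →ₗ[k] k) (hs : s ≠ 0) :
    ∃ γ : K, γ ≠ 0 ∧ s γ = 0 ∧ s (γ * θ) ≠ 0 := by
  have hli : LinearIndependent k ![1, θ] := by
    rw [LinearIndependent.pair_iff]
    intro a b hab
    have hb : b = 0 := by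
      by_contra hb
      refine algebraMap_ne_of_sq_eq hd hθ (-(a / b)) ?_
      have hb' : algebraMap k K b ≠ 0 := by simpa using hb
      rw [map_neg, map_div₀, ← neg_div, div_eq_iff hb']
      simp only [Algebra.smul_def] at hab
      linear_combination -hab
    subst hb
    simpa using hab
  have hspan := hli.span_eq_top_of_card_eq_finrank' (by simp [hK])
  obtain ⟨γ, hγ, hγ0⟩ := (Submodule.ne_bot_iff _).1
    (LinearMap.ker_ne_bot_of_finrank_lt (f := s) (by simp [hK]))
  refine ⟨γ, hγ0, hγ, fun h0 => hs ?_⟩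
  ext x
  have hx : x / γ ∈ Submodule.span k (Set.range ![1, θ]) := hspan ▸ Submodule.mem_top
  rw [Matrix.range_cons_cons_empty, Submodule.mem_span_pair] at hx
  obtain ⟨a, b, hab⟩ := hx
  have : x = a • γ + b • (γ * θ) := by
    rw [eq_div_iff hγ0] at hab
    rw [← hab]
    simp only [Algebra.smul_def]
    ring
  rw [this, map_add, map_smul, map_smul, h0, LinearMap.mem_ker.1 hγ]
  simp

/-- Transfers from a quadratic extension contain the multiples of `⟨1, -N⟩`, for norms `N`. -/
theorem exists_unary_add_unary_mem_range_transfer (hK : Module.finrank k K = 2) {d : k}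
    (hd : ¬ IsSquare d) {θ : K} (hθ : θ ^ 2 = algebraMap k K d) (s : K →ₗ[k] k) (hs : s ≠ 0) :
    (∀ (r : k) (N : kˣ), (N : k) = r ^ 2 - d →
      ∃ t : kˣ, unary t + unary (-(t * N)) ∈ (transfer s hs).range) ∧
    ∃ t : kˣ, unary t + unary (-t) ∈ (transfer s hs).range := by
  obtain ⟨γ, hγ0, hγ, hc⟩ := exists_apply_eq_zero_apply_mul_ne_zero hK hd hθ s hs
  have hs' : ∀ a b : k, s (γ * (algebraMap k K a + algebraMap k K b * θ)) = b * s (γ * θ) := by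
    intro a b
    have : γ * (algebraMap k K a + algebraMap k K b * θ) = a • γ + b • (γ * θ) := by
      simp only [Algebra.smul_def]
      ring
    rw [this, map_add, map_smul, map_smul, hγ, smul_zero, zero_add, smul_eq_mul]
  refine ⟨fun r N hN => ⟨Units.mk0 _ hc, ?_⟩, ⟨Units.mk0 _ hc * Units.mk0 2 (Invertible.ne_zero 2), ?_⟩⟩
  · have hα : γ * (algebraMap k K r + θ) ≠ 0 := by
      refine mul_ne_zero hγ0 fun h0 => algebraMap_ne_of_sq_eq hd hθ (-r) ?_
      rw [map_neg]
      linear_combination -h0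
    -- Put `c = s(γθ)` and `α = γ(r + θ)`. Then `α`, `α(r - θ)² = γN(r - θ)` and `α(r - θ) = γN`
    -- have images `c`, `-cN` and `0`, so `1` and `r - θ` diagonalize the form as `⟨c, -cN⟩`.
    refine unary_add_unary_mem_range_transfer hK s hs (Units.mk0 _ hα) 1
      (algebraMap k K r - θ) _ _ ?_ ?_ ?_
    · have := hs' r 1
      simpa using this
    · have := hs' (r ^ 3 - r * d) (-(r ^ 2 - d))
      rw [Units.val_neg, Units.val_mul, Units.val_mk0, Units.val_mk0, hN]
      convert this using 2
      · simp only [map_sub, map_mul, map_pow, map_neg, ← hθ]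
        ring
      · ring
    · have := hs' (r ^ 2 - d) 0
      rw [Units.val_mk0]
      convert this using 2
      · simp only [map_sub, map_zero, map_pow, ← hθ]
        ring
      · ring
  -- Here `(1 ± θ)² = 1 + d ± 2θ` and `(1 + θ)(1 - θ) = 1 - d`, so scaling by `γ` gives `⟨2c, -2c⟩`
  -- with `c = s(γθ)`.
  · refine unary_add_unary_mem_range_transfer hK s hs (Units.mk0 _ hγ0) (1 + θ) (1 - θ) _ _ ?_ ?_ ?_
    · have := hs' (1 + d) 2
      rw [Units.val_mul, Units.val_mk0, Units.val_mk0, Units.val_mk0, mul_comm _ (2 : k)]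
      convert this using 2
      simp only [map_add, map_one, map_ofNat, ← hθ]
      ring
    · have := hs' (1 + d) (-2)
      rw [Units.val_neg, Units.val_mul, Units.val_mk0, Units.val_mk0, Units.val_mk0]
      convert this using 2
      · simp only [map_add, map_one, map_neg, map_ofNat, ← hθ]
        ring
      · ring
    · have := hs' (1 - d) 0
      rw [Units.val_mk0]
      convert this using 2
      · simp only [map_sub, map_zero, map_one, ← hθ]
        ring
      · ring

end QuadraticExtension

/-! ### Values of `q` and orthogonal vectors. -/

section Values

variable {k : Type u} [Field k] [Invertible (2 : k)] {n : ℕ} {q : QuadraticForm k (Fin n → k)}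

theorem matrixValueSqGroup_toMatrix' (q : QuadraticForm k (Fin n → k)) :
    matrixValueSqGroup q.toMatrix' = valueSqGroup q := by
  refine congrArg Subgroup.closure (Set.ext fun c => ⟨?_, ?_⟩)
  · rintro ⟨v, w, h⟩
    rw [matrixValue_toMatrix'_self, matrixValue_toMatrix'_self] at h
    have h0 : q v * q w ≠ 0 := h ▸ c.ne_zero
    exact ⟨Units.mk0 _ (left_ne_zero_of_mul h0), ⟨v, rfl⟩,
      Units.mk0 _ (right_ne_zero_of_mul h0), ⟨w, rfl⟩, by ext; simp [h]⟩
  · rintro ⟨a, ⟨v, hv⟩, b, ⟨w, hw⟩, rfl⟩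
    exact ⟨v, w, by simp [matrixValue_toMatrix'_self, hv, hw]⟩

/-- The value group of a regular isotropic form is everything. -/
theorem valueSqGroup_eq_top (hq : q.Nondegenerate) {v : Fin n → k} (hv : v ≠ 0) (hv0 : q v = 0) :
    valueSqGroup q = ⊤ := by
  obtain ⟨y, hy⟩ : ∃ y, QuadraticMap.associated q v y ≠ 0 := by
    by_contra! h
    exact hv ((nondegenerate_iff q).1 hq v h)
  have hp : QuadraticMap.polar q v y ≠ 0 := by
    rw [← QuadraticMap.polarBilin_apply_apply, ← QuadraticMap.two_nsmul_associated k]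
    rw [LinearMap.smul_apply, LinearMap.smul_apply, nsmul_eq_mul, Nat.cast_ofNat]
    exact mul_ne_zero (Invertible.ne_zero 2) hy
  have hval : ∀ c : kˣ, c ∈ valueSet q := fun c => by
    -- As `q v = 0`, `q (t • v + y)` is affine in `t` with slope `polar q v y ≠ 0`; solve for the
    -- value `c`.
    refine ⟨((c - q y) / QuadraticMap.polar q v y) • v + y, ?_⟩
    rw [QuadraticMap.map_add q, QuadraticMap.map_smul, hv0, QuadraticMap.polar_smul_left]
    simp only [smul_eq_mul]
    field_simp
    ring
  exact eq_top_iff.2 fun c _ => Subgroup.subset_closure ⟨1, hval 1, c, hval c, (one_mul c).symm⟩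

theorem exists_orthogonal_decomposition (q : QuadraticForm k (Fin n → k)) {v : Fin n → k}
    (hv : q v ≠ 0) (w : Fin n → k) :
    ∃ (r : k) (w' : Fin n → k), w = r • v + w' ∧ q (v + w') = q v + q w' := by
  have h2 : (2 : k) ≠ 0 := Invertible.ne_zero 2
  refine ⟨QuadraticMap.polar q v w / (2 * q v), w - (QuadraticMap.polar q v w / (2 * q v)) • v,
    by simp, ?_⟩
  have h : QuadraticMap.polar q v (w - (QuadraticMap.polar q v w / (2 * q v)) • v) = 0 := by
    rw [QuadraticMap.polar_sub_right, QuadraticMap.polar_smul_right, QuadraticMap.polar_self]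
    simp only [smul_eq_mul, nsmul_eq_mul, Nat.cast_ofNat]
    field_simp
    ring
  rw [QuadraticMap.map_add q, h, add_zero]

omit [Invertible (2 : k)] in
theorem map_smul_add_of_orthogonal {v w : Fin n → k} (h : q (v + w) = q v + q w) (r : k) :
    q (r • v + w) = r ^ 2 * q v + q w := by
  have h0 : QuadraticMap.polar q v w = 0 := by rw [QuadraticMap.polar, h]; ring
  rw [QuadraticMap.map_add q, QuadraticMap.map_smul, QuadraticMap.polar_smul_left, h0]
  simp [sq]

end Values

/-! ### The transfer ideal of an isotropic and of an anisotropic quadric. -/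

section TransferIdeal

open AlgebraicGeometry

variable {k : Type u} [Field k] [Invertible (2 : k)]

theorem mem_transferIdeal_of_mem_range {X : Scheme.{u}} [X.Over (Spec (.of k))]
    [LocallyOfFiniteType (X ↘ Spec (.of k))] {s : ∀ x : X, ResidueField k X x →ₗ[k] k}
    {hs : ∀ x : X, IsClosed {x} → s x ≠ 0} {x : X} (hx : IsClosed {x})
    [FiniteDimensional k (ResidueField k X x)] {φ : GW k}
    (h : φ ∈ (transfer (s x) (hs x hx)).range) : φ ∈ transferIdeal X s hs :=
  AddSubgroup.mem_iSup_of_mem (S := fun x : {x : X // IsClosed {x}} =>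
    haveI := finite_residueField k X x.2
    (transfer (s x) (hs x x.2)).range) ⟨x, hx⟩ h

theorem mem_of_mem_transferIdeal {X : Scheme.{u}} [X.Over (Spec (.of k))]
    [LocallyOfFiniteType (X ↘ Spec (.of k))] {s : ∀ x : X, ResidueField k X x →ₗ[k] k}
    {hs : ∀ x : X, IsClosed {x} → s x ≠ 0} (A : AddSubgroup (GW k))
    (hA : ∀ (x : X) (hx : IsClosed {x}) [FiniteDimensional k (ResidueField k X x)]
      (ψ : GW (ResidueField k X x)), transfer (s x) (hs x hx) ψ ∈ A)
    {φ : GW k} (h : φ ∈ transferIdeal X s hs) : φ ∈ A := by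
  have hle : (⨆ x : {x : X // IsClosed {x}},
      haveI := finite_residueField k X x.2
      (transfer (s x) (hs x x.2)).range) ≤ A := by
    refine iSup_le fun x => ?_
    rintro _ ⟨ψ, rfl⟩
    have := finite_residueField k X x.2
    exact hA x.1 x.2 ψ
  exact hle h

variable {n : ℕ} {q : QuadraticForm k (Fin n → k)}
  {s : ∀ x : quadric q, ResidueField k (quadric q) x →ₗ[k] k}
  {hs : ∀ x, IsClosed {x} → s x ≠ 0}

/-- A rational point has residue field of degree 1; choosing `α` with `s α = 1`, the transfer of
`⟨α⟩` is `⟨1⟩`. -/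
theorem transferIdeal_eq_top (h : HasZero q.toMatrix' k) :
    transferIdeal (quadric q) s hs = ⊤ := by
  obtain ⟨x, hx, ⟨ψ⟩⟩ := exists_closed_point q h
  have hfin := finite_residueField k (quadric q) hx
  have h1 : Module.finrank k (ResidueField k (quadric q) x) = 1 := by
    have h2 := LinearMap.finrank_le_finrank_of_injective (f := ψ.toLinearMap)
      ψ.toRingHom.injective
    have h3 := Module.finrank_pos (R := k) (M := ResidueField k (quadric q) x)
    rw [Module.finrank_self] at h2
    omega
  obtain ⟨α, hα⟩ := LinearMap.surjective (hs x hx) 1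
  have hα0 : α ≠ 0 := by
    rintro rfl
    simp at hα
  rw [Ideal.eq_top_iff_one]
  refine mem_transferIdeal_of_mem_range hx ⟨unary (Units.mk0 α hα0), ?_⟩
  have he : (((1 : kˣ) : k) • QuadraticMap.sq : QuadraticForm k k).Equivalent
      ((s x).compQuadraticMap' (α • QuadraticMap.sq :
        QuadraticForm (ResidueField k (quadric q) x) (ResidueField k (quadric q) x))) := by
    refine equivalent_of_linearMap (nondegenerate_smul_sq 1)
      (Algebra.linearMap k (ResidueField k (quadric q) x)) (fun v => ?_) (by simp [h1])
    have : α * (algebraMap k (ResidueField k (quadric q) x) v * algebraMap k _ v) =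
        (v * v) • α := by
      rw [Algebra.smul_def, map_mul]
      ring
    simp [this, hα]
  rw [transfer_unary, ← unary_one]
  exact congrArg GW.of (IsoClass.mk_eq (S := .transferUnary (s x) (hs x hx) (Units.mk0 α hα0))
    (T := .unary 1) he.symm)

theorem mem_discSubgroup_of_mem_transferIdeal [PerfectField k] (hA : ¬ HasZero q.toMatrix' k)
    {φ : GW k} (h : φ ∈ transferIdeal (quadric q) s hs) :
    φ ∈ discSubgroup ((valueSqGroup q).map (squareClass k)) := by
  refine mem_of_mem_transferIdeal _ (fun x hx _ ψ => ?_) h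
  have hz := hasZero_residueField q x
  refine transfer_mem_discSubgroup (s x) (hs x hx) (even_finrank_of_hasZero hA hz) _
    (fun y u hu => ?_) ψ
  rw [← matrixValueSqGroup_toMatrix']
  exact norm_mem_matrixValueSqGroup hA hz y u hu

/-- Removes, by multiplication with `⟨t⁻¹⟩`, the scalar `t` that depends on the choice of
functional. -/
theorem unary_one_add_unary_mem_of_smul (I : Ideal (GW k)) {t N : kˣ}
    (h : unary t + unary (-(t * N)) ∈ I) : unary 1 + unary (-N) ∈ I := by
  have := I.mul_mem_left (unary t⁻¹) h
  rw [mul_add, unary_mul_unary, unary_mul_unary] at this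
  simpa using this

/-- Over `k(θ)` with `θ² = -q(w)/q(v)` the vector `θv + w` is isotropic. The resulting point has
residue field inside `k(θ)`, and Springer's theorem forbids degree 1. -/
theorem exists_closed_point_finrank_eq_two [PerfectField k] (hA : ¬ HasZero q.toMatrix' k)
    {v w : Fin n → k} (hv : v ≠ 0) (hw : w ≠ 0) (hvw : q (v + w) = q v + q w) :
    ¬ IsSquare (-(q w / q v)) ∧ ∃ x : quadric q, IsClosed {x} ∧
      Module.finrank k (ResidueField k (quadric q) x) = 2 ∧
      ∃ θ : ResidueField k (quadric q) x, θ ^ 2 = algebraMap k _ (-(q w / q v)) := by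
  have han : ∀ y : Fin n → k, q y = 0 → y = 0 := fun y hy => by
    by_contra h
    exact hA ⟨y, h, by rw [matrixValue_toMatrix'_self, hy]⟩
  have hqv : q v ≠ 0 := fun h => hv (han v h)
  have hqw : q w ≠ 0 := fun h => hw (han w h)
  have hd : ¬ IsSquare (-(q w / q v)) := by
    rintro ⟨r, hr⟩
    -- If the quotient were `r²`, anisotropy would force `w = -rv`, so `q w = r² q v = -q w`,
    -- impossible in characteristic not 2.
    have h1 : q (r • v + w) = 0 := by
      rw [map_smul_add_of_orthogonal hvw, sq, ← hr]
      field_simp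
      ring
    have h2 : w = (-r) • v := by
      rw [neg_smul]
      exact eq_neg_of_add_eq_zero_right (han _ h1)
    have h3 : q w = r * r * q v := by rw [h2, QuadraticMap.map_smul]; simp
    rw [← hr] at h3
    have h4 : 2 * q w = 0 := by
      rw [neg_mul, div_mul_cancel₀ _ hqv] at h3
      linear_combination h3
    exact (mul_ne_zero (Invertible.ne_zero 2) hqw) h4
  refine ⟨hd, ?_⟩
  set d := -(q w / q v) with hdd
  have hdq : d * q v = -q w := by rw [hdd, neg_mul, div_mul_cancel₀ _ hqv]
  have hirr : Irreducible (Polynomial.X ^ 2 - Polynomial.C d) :=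
    (X_pow_sub_C_irreducible_of_prime Nat.prime_two fun b hb => hd ⟨b, by rw [← hb, sq]⟩)
  have : Fact (Irreducible (Polynomial.X ^ 2 - Polynomial.C d)) := ⟨hirr⟩
  let E := AdjoinRoot (Polynomial.X ^ 2 - Polynomial.C d)
  have hne : (Polynomial.X ^ 2 - Polynomial.C d) ≠ 0 := hirr.ne_zero
  let pb : PowerBasis k E := AdjoinRoot.powerBasis hne
  have hfin : FiniteDimensional k E := pb.finite
  have hE : Module.finrank k E = 2 := by
    rw [pb.finrank, AdjoinRoot.powerBasis_dim, Polynomial.natDegree_X_pow_sub_C]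
  let θ : E := AdjoinRoot.root _
  have hθ : θ ^ 2 = algebraMap k E d := by
    have := AdjoinRoot.eval₂_root (Polynomial.X ^ 2 - Polynomial.C d)
    have h : AdjoinRoot.root (Polynomial.X ^ 2 - Polynomial.C d) ^ 2 = AdjoinRoot.of _ d := by
      simpa [sub_eq_zero] using this
    exact h
  have hzero : HasZero q.toMatrix' E := by
    refine ⟨fun i => θ * algebraMap k E (v i) + algebraMap k E (w i), fun h0 => ?_, ?_⟩
    · obtain ⟨i, hi⟩ := Function.ne_iff.1 hv
      have hi' : algebraMap k E (v i) ≠ 0 := by simpa using hi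
      refine algebraMap_ne_of_sq_eq hd hθ (-(w i / v i)) ?_
      have := congrFun h0 i
      rw [map_neg, map_div₀, ← neg_div, div_eq_iff hi']
      simp only [Pi.zero_apply] at this
      linear_combination -this
    · have hval : ∀ y : Fin n → k, matrixValue q.toMatrix' (fun i => algebraMap k E (y i)) =
          algebraMap k E (q y) := fun y => by
        rw [← matrixValue_toMatrix'_self]
        exact matrixValue_map (Algebra.ofId k E) y
      have h1 := hval (v + w)
      simp only [Pi.add_apply, map_add] at h1
      rw [matrixValue_mul_add, h1, hval, hval, hθ, hvw, map_add]
      have h2 : algebraMap k E d * algebraMap k E (q v) = -algebraMap k E (q w) := by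
        rw [← map_mul, ← map_neg, hdq]
      linear_combination h2
  obtain ⟨x, hx, ⟨ψ⟩⟩ := exists_closed_point q hzero
  have := finite_residueField k (quadric q) hx
  have hψ := LinearMap.finrank_le_finrank_of_injective (f := ψ.toLinearMap)
      ψ.toRingHom.injective
  have h2 : Module.finrank k (ResidueField k (quadric q) x) = 2 := by
    obtain ⟨e, he⟩ := even_finrank_of_hasZero hA (hasZero_residueField q x)
    have h3 := Module.finrank_pos (R := k) (M := ResidueField k (quadric q) x)
    omega
  refine ⟨x, hx, h2, ?_⟩
  obtain ⟨y, hy⟩ := (LinearMap.injective_iff_surjective_of_finrank_eq_finrank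
    (f := ψ.toLinearMap) (h2.trans hE.symm)).1 ψ.toRingHom.injective θ
  refine ⟨y, ψ.toRingHom.injective ?_⟩
  change ψ y = θ at hy
  change ψ (y ^ 2) = ψ (algebraMap _ _ d)
  rw [map_pow, hy, hθ, ψ.commutes]

theorem unary_one_add_unary_neg_mem_of_orthogonal [PerfectField k] (hA : ¬ HasZero q.toMatrix' k)
    {v w : Fin n → k} (hv : v ≠ 0) (hw : w ≠ 0) (hvw : q (v + w) = q v + q w) :
    (∀ (r : k) (N : kˣ), (N : k) = r ^ 2 + q w / q v →
      unary 1 + unary (-N) ∈ transferIdeal (quadric q) s hs) ∧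
    unary 1 + unary (-1) ∈ transferIdeal (quadric q) s hs := by
  obtain ⟨hd, x, hx, h2, θ, hθ⟩ := exists_closed_point_finrank_eq_two hA hv hw hvw
  have := finite_residueField k (quadric q) hx
  obtain ⟨h3, t, h4⟩ :=
    exists_unary_add_unary_mem_range_transfer h2 hd hθ (s x) (hs x hx)
  refine ⟨fun r N hN => ?_, ?_⟩
  · obtain ⟨t, ht⟩ := h3 r N (by rw [hN, sub_neg_eq_add])
    exact unary_one_add_unary_mem_of_smul _ (mem_transferIdeal_of_mem_range hx ht)
  · exact unary_add_unary_neg t ▸ mem_transferIdeal_of_mem_range hx h4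

/-- Two variables provide orthogonal nonzero `v` and `w`: the component of the second basis vector
orthogonal to the first is nonzero. -/
theorem unary_one_add_unary_neg_one_mem [PerfectField k] (hn : 2 ≤ n)
    (hA : ¬ HasZero q.toMatrix' k) :
    unary 1 + unary (-1) ∈ transferIdeal (quadric q) s hs := by
  let v : Fin n → k := Pi.single ⟨0, by omega⟩ 1
  let z : Fin n → k := Pi.single ⟨1, by omega⟩ 1
  have hv : v ≠ 0 := by simp [v]
  have hqv : q v ≠ 0 := fun h => hA ⟨v, hv, by rw [matrixValue_toMatrix'_self, h]⟩
  obtain ⟨r, w, hz, hw⟩ := exists_orthogonal_decomposition q hqv z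
  refine (unary_one_add_unary_neg_mem_of_orthogonal hA hv ?_ hw).2
  rintro rfl
  have := congrFun hz ⟨1, by omega⟩
  simp [v, z] at this

/-- For a generator `ab` write `a = q(v)` and `b = q(rv + w)` with `w` orthogonal to `v`. Up to
squares `ab` is `b/a = r² + q(w)/q(v)`, a norm from a residue field of degree 2; if `w = 0` it is a
square, and the hyperbolic plane suffices. -/
theorem unary_one_add_unary_neg_mem [PerfectField k] (hn : 2 ≤ n) (hA : ¬ HasZero q.toMatrix' k)
    {c : kˣ} (hc : c ∈ valueSqGroup q) :
    unary 1 + unary (-c) ∈ transferIdeal (quadric q) s hs := by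
  have hH := unary_one_add_unary_neg_one_mem (s := s) (hs := hs) hn hA
  induction hc using Subgroup.closure_induction with
  | mem c h =>
    obtain ⟨a, ⟨v, hv⟩, b, ⟨z, hz⟩, rfl⟩ := h
    have hqv : q v ≠ 0 := hv ▸ a.ne_zero
    have hv0 : v ≠ 0 := by
      rintro rfl
      simp at hqv
    obtain ⟨r, w, rfl, hvw⟩ := exists_orthogonal_decomposition q hqv z
    rw [map_smul_add_of_orthogonal hvw] at hz
    by_cases hw : w = 0
    · subst hw
      have hr : r ≠ 0 := by
        rintro rfl
        simp [eq_comm] at hz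
      have : -(a * b) = -1 * (a * Units.mk0 r hr) ^ 2 := by
        ext
        simp [← hz, hv]
        ring
      rwa [this, unary_mul_sq]
    · have h := (unary_one_add_unary_neg_mem_of_orthogonal (s := s) (hs := hs) hA hv0 hw hvw).1 r
        (a⁻¹ * b) (by simp [← hz, hv]; field_simp)
      have h' : -(a * b) = -(a⁻¹ * b) * a ^ 2 := by
        ext
        simp
        field_simp
      rwa [h', unary_mul_sq]
  | one => exact hH
  | mul c d _ _ hc hd =>
    -- `⟨1, -cd⟩ = ⟨1, -c⟩ + ⟨c⟩⟨1, -d⟩ - ⟨c, -c⟩`, where `⟨c, -c⟩` is the hyperbolic plane.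
    have h := sub_mem (add_mem hc (Ideal.mul_mem_left _ (unary c) hd)) hH
    rw [← unary_add_unary_neg c, mul_add, unary_mul_unary, unary_mul_unary, mul_one, mul_neg] at h
    convert h using 1
    abel
  | inv c _ hc =>
    have : -c⁻¹ = -c * c⁻¹ ^ 2 := by
      ext
      simp
      field_simp
    rwa [this, unary_mul_sq]

end TransferIdeal

end GWTransfer

theorem lemma3p6 {k : Type u} [Field k] [PerfectField k] [Invertible (2 : k)]
    {n : ℕ} (hn : 2 ≤ n) (q : QuadraticForm k (Fin n → k)) (hq : q.Nondegenerate)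
    (s : ∀ x : GWTransfer.quadric q, GWTransfer.ResidueField k (GWTransfer.quadric q) x →ₗ[k] k)
    (hs : ∀ x, IsClosed {x} → s x ≠ 0) :
    (∀ φ ∈ GWTransfer.transferIdeal (GWTransfer.quadric q) s hs,
      GWTransfer.signedDisc φ ∈
        (GWTransfer.valueSqGroup q).map (GWTransfer.squareClass k)) ∧
    (∀ a b : kˣ,
      GWTransfer.binary a b ∈ GWTransfer.transferIdeal (GWTransfer.quadric q) s hs ↔
        -(a * b) ∈ GWTransfer.valueSqGroup q) := by
  open GWTransfer in
  by_cases hA : HasZero q.toMatrix' k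
  · have hI := transferIdeal_eq_top (s := s) (hs := hs) hA
    obtain ⟨v, hv, hv0⟩ := hA
    rw [hI, valueSqGroup_eq_top hq hv (by rw [← matrixValue_toMatrix'_self, hv0])]
    refine ⟨fun φ _ => ?_, fun a b => by simp⟩
    obtain ⟨c, hc⟩ := QuotientGroup.mk'_surjective _ (signedDisc φ)
    exact ⟨c, trivial, hc⟩
  · refine ⟨fun φ hφ => (mem_discSubgroup_of_mem_transferIdeal hA hφ).2, fun a b => ⟨fun h => ?_,
      fun h => ?_⟩⟩
    · obtain ⟨c, hc, hcd⟩ := (mem_discSubgroup_of_mem_transferIdeal hA h).2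
      rw [signedDisc_binary] at hcd
      -- The discriminant determines `-ab` only up to a square `t²`, which itself lies in the value
      -- group.
      obtain ⟨t, ht⟩ := QuotientGroup.eq.1 hcd
      have : Nonempty (Fin n) := ⟨⟨0, by omega⟩⟩
      have ht2 := matrixValueSqGroup_toMatrix' q ▸ sq_mem_matrixValueSqGroup hA t
      rw [eq_inv_mul_iff_mul_eq] at ht
      exact ht ▸ mul_mem hc ht2
    -- Taking `c = -ab`, `⟨a⟩⟨1, ab⟩ = ⟨a, a²b⟩ = ⟨a, b⟩`.
    · have h1 := Ideal.mul_mem_left _ (unary a)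
        (unary_one_add_unary_neg_mem (s := s) (hs := hs) hn hA h)
      rw [neg_neg, mul_add, unary_mul_unary, unary_mul_unary, mul_one, ← mul_assoc, ← sq,
        mul_comm (a ^ 2), unary_mul_sq] at h1
      rwa [binary_eq]
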